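/- A planar convex body is a compact convex set $K\subset\mathbb R^2$ with non-empty interior; $|K|$ denotes its area (Lebesgue measure) and $$\omega(K)=\min_{|u|=1}\Big(\max_{x\in K}\langle u,x\rangle-\min_{x\in K}\langle u,x\rangle\Big)$$ its minimal width, i.e. the minimal distance between two parallel supporting lines of $K$. Define the Fraenkel asymmetry of $K$ with respect to equilateral triangles by $$\mathcal A_E(K)=\min\left\{\frac{|K\,\Delta\,E|}{\omega(E)^2}\ :\ E \text{ a (closed, filled, nondegenerate) equilateral triangle with } \omega(E)=\omega(K)\right\},$$ where $K\,\Delta\,E=(K\setminus E)\cup(E\setminus K)$. **Theorem (quantitative Pál inequality via Fraenkel asymmetry).** There exists a constant $c_3>0$ such that for every planar convex body $K$ the minimum defining $\mathcal A_E(K)$ is attained and $$\frac{|K|}{\omega(K)^2}-\frac{1}{\sqrt 3}\ \ge\ c_3\,\mathcal A_E(K).$$ Moreover, one can take $c_3=\dfrac{1}{25\,(3\sqrt3+2)\,\sqrt5}$. -/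

import Mathlib

open scoped symmDiff

noncomputable section

/-- The Euclidean plane; its `volume` is two-dimensional Lebesgue measure. -/
abbrev Plane : Type := EuclideanSpace ℝ (Fin 2)

/-- The distance between the two supporting lines of `K` that are orthogonal to the unit
vector `u`, i.e. the length of the orthogonal projection of `K` onto the line spanned by `u`. -/
def directionalWidth (K : Set Plane) (u : Plane) : ℝ :=
  sSup ((fun x : Plane => inner ℝ u x) '' K) - sInf ((fun x : Plane => inner ℝ u x) '' K)

/-- The (minimal) width `ω(K)`: the smallest directional width over all unit vectors. -/
def minimalWidth (K : Set Plane) : ℝ :=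
  sInf (directionalWidth K '' Metric.sphere (0 : Plane) 1)

/-- `E` is a (nondegenerate, closed, filled) equilateral triangle. -/
def IsEquilateralTriangle (E : Set Plane) : Prop :=
  ∃ t : Affine.Triangle ℝ Plane, t.Equilateral ∧ E = convexHull ℝ (Set.range t.points)

/-- The values `|K Δ E| / ω(E)²`, for `E` an equilateral triangle with `ω(E) = ω(K)`. -/
def asymmetryValues (K : Set Plane) : Set ℝ :=
  {a | ∃ E : Set Plane, IsEquilateralTriangle E ∧ minimalWidth E = minimalWidth K ∧
    a = MeasureTheory.volume.real (K ∆ E) / minimalWidth E ^ 2}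

/-- The Fraenkel asymmetry with respect to equilateral triangles. The theorem also states that
this infimum is a minimum. -/
def fraenkelAsymmetry (K : Set Plane) : ℝ :=
  sInf (asymmetryValues K)

end

namespace Pal

open MeasureTheory Metric Set

/-! ### Coordinates and areas of triangles -/

/-! Write `w` for the minimal width, `r` for the inradius and `δ` for the deficit `|K| / w² - 1 /
√3`. An equilateral triangle of width `w` is `tri v z w` for a frame `v` of unit normals with sum
zero, and its area is `w² / √3`. Minimising the symmetric difference therefore amounts to maximising
the overlap with `K`, which is upper semicontinuous in `(v, z)`. Frames form a compact set and
distant centers give no overlap, so the minimum is attained (`isLeast_fraenkelAsymmetry`).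

For the inequality, a large `δ` is handled by `|K ∆ E| ≤ |K| + |E|`. For small `δ`, comparison with
the area of the incircle gives `r < w / 2`. Maximality of the incircle puts `0` in the convex hull
of its contact normals. A point of `K` at distance at least `w` from a contact line shows that each
weight in such a balance is at most `r / w < 1 / 2`, so exactly three normals occur
(`exists_three_contactNormals`) and `r ≥ w / 3`.

Opposite each contact line lies a point of `K` at distance at least `w - r` from the incenter. The
disc together with the three disjoint caps towards these points gives `|K| ≥ (3√3 / 2) r (w - r)`
(`area_ge`). With `r = (1/3 + ε) w` this reads `δ ≥ (3√3 / 2) ε (1/3 - ε)`, which yields Pál's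
inequality and makes `ε` linear in `δ`.

The three weights are then within `2ε` of `1/3`, so the contact normals are within `20ε` of a frame
(`exists_frame_near`), and `K` lies in a concentric equilateral triangle of width `(1 + O(ε)) w`
(`subset_tri_of_near`). Since `|K| ≥ w² / √3`, the symmetric difference with the triangle of width
`w` is `O(ε) w²`, hence `O(δ) w²`. -/

lemma inner_eq_coord (x y : Plane) : inner ℝ x y = x 0 * y 0 + x 1 * y 1 := by
  simp [PiLp.inner_apply, Fin.sum_univ_two, mul_comm]

lemma norm_sq_eq_coord (x : Plane) : ‖x‖ ^ 2 = x 0 ^ 2 + x 1 ^ 2 := by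
  rw [← real_inner_self_eq_norm_sq, inner_eq_coord]; ring

/-- The signed area of the parallelogram spanned by two vectors of the plane. -/
def cross (a b : Plane) : ℝ := a 0 * b 1 - a 1 * b 0

/-- The linear map that takes the standard basis to `a`, `b`. -/
noncomputable def columnMap (a b : Plane) : Plane →ₗ[ℝ] Plane where
  toFun x := x 0 • a + x 1 • b
  map_add' x y := by simp only [PiLp.add_apply]; module
  map_smul' c x := by simp only [PiLp.smul_apply, smul_eq_mul, RingHom.id_apply]; module

lemma det_columnMap (a b : Plane) : LinearMap.det (columnMap a b) = cross a b := by
  rw [← LinearMap.det_toMatrix (EuclideanSpace.basisFun (Fin 2) ℝ).toBasis]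
  rw [Matrix.det_fin_two]
  simp [LinearMap.toMatrix_apply, columnMap, cross]
  ring

/-- The open version is for the caps in `exists_cap`, whose two halves must be disjoint and
measurable. The closed one gives the area of `tri`. -/
def openUnitTriangle : Set Plane := {x | 0 < x 0 ∧ 0 < x 1 ∧ x 0 + x 1 < 1}

def closedUnitTriangle : Set Plane := {x | 0 ≤ x 0 ∧ 0 ≤ x 1 ∧ x 0 + x 1 ≤ 1}

lemma volume_coord_preimage {s : Set (ℝ × ℝ)} (hs : MeasurableSet s) :
    volume {x : Plane | (x 0, x 1) ∈ s} = volume s := by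
  have h1 := (EuclideanSpace.volume_preserving_symm_measurableEquiv_toLp (Fin 2))
  have h2 := volume_preserving_finTwoArrow ℝ
  exact (h2.comp h1).measure_preimage hs.nullMeasurableSet

lemma lintegral_one_sub : ∫⁻ x in Icc (0 : ℝ) 1, ENNReal.ofReal (1 - x) = ENNReal.ofReal (1 / 2) := by
  rw [← ofReal_integral_eq_lintegral_ofReal]
  · rw [integral_Icc_eq_integral_Ioc, ← intervalIntegral.integral_of_le zero_le_one]
    rw [intervalIntegral.integral_sub (by simp) (by simp)]
    norm_num
  · exact (continuous_const.sub continuous_id).continuousOn.integrableOn_Icc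
  · filter_upwards [ae_restrict_mem measurableSet_Icc] with x hx
    simpa using hx.2

lemma volume_closedUnitTriangle : volume closedUnitTriangle = ENNReal.ofReal (1 / 2) := by
  have hm : MeasurableSet {p : ℝ × ℝ | 0 ≤ p.1 ∧ 0 ≤ p.2 ∧ p.1 + p.2 ≤ 1} := by measurability
  have := volume_coord_preimage hm
  refine this.trans ?_
  rw [Measure.volume_eq_prod, Measure.prod_apply hm, ← lintegral_one_sub,
    ← lintegral_indicator measurableSet_Icc]
  refine lintegral_congr fun x => ?_
  by_cases hx : x ∈ Icc (0 : ℝ) 1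
  · rw [indicator_of_mem hx]
    have : (Prod.mk x ⁻¹' {p : ℝ × ℝ | 0 ≤ p.1 ∧ 0 ≤ p.2 ∧ p.1 + p.2 ≤ 1}) = Icc 0 (1 - x) := by
      ext y
      simp only [mem_preimage, mem_ofPred_eq, mem_Icc]
      constructor
      · rintro ⟨h1, h2, h3⟩; exact ⟨h2, by linarith⟩
      · rintro ⟨h1, h2⟩; exact ⟨hx.1, h1, by linarith⟩
    rw [this, Real.volume_Icc, sub_zero]
  · rw [indicator_of_notMem hx]
    have : (Prod.mk x ⁻¹' {p : ℝ × ℝ | 0 ≤ p.1 ∧ 0 ≤ p.2 ∧ p.1 + p.2 ≤ 1}) = ∅ := by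
      ext y
      simp only [mem_preimage, mem_ofPred_eq, mem_empty_iff_false, iff_false]
      rintro ⟨h1, h2, h3⟩; exact hx ⟨h1, by linarith⟩
    rw [this, measure_empty]

lemma volume_openUnitTriangle : volume openUnitTriangle = ENNReal.ofReal (1 / 2) := by
  have hm : MeasurableSet {p : ℝ × ℝ | 0 < p.1 ∧ 0 < p.2 ∧ p.1 + p.2 < 1} := by measurability
  have := volume_coord_preimage hm
  refine this.trans ?_
  rw [Measure.volume_eq_prod, Measure.prod_apply hm, ← lintegral_one_sub,
    setLIntegral_congr Ioo_ae_eq_Icc.symm, ← lintegral_indicator measurableSet_Ioo]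
  refine lintegral_congr fun x => ?_
  by_cases hx : x ∈ Ioo (0 : ℝ) 1
  · rw [indicator_of_mem hx]
    have : (Prod.mk x ⁻¹' {p : ℝ × ℝ | 0 < p.1 ∧ 0 < p.2 ∧ p.1 + p.2 < 1}) = Ioo 0 (1 - x) := by
      ext y
      simp only [mem_preimage, mem_ofPred_eq, mem_Ioo]
      constructor
      · rintro ⟨h1, h2, h3⟩; exact ⟨h2, by linarith⟩
      · rintro ⟨h1, h2⟩; exact ⟨hx.1, h1, by linarith⟩
    rw [this, Real.volume_Ioo, sub_zero]
  · rw [indicator_of_notMem hx]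
    have : (Prod.mk x ⁻¹' {p : ℝ × ℝ | 0 < p.1 ∧ 0 < p.2 ∧ p.1 + p.2 < 1}) = ∅ := by
      ext y
      simp only [mem_preimage, mem_ofPred_eq, mem_empty_iff_false, iff_false]
      rintro ⟨h1, h2, h3⟩; exact hx ⟨h1, by linarith⟩
    rw [this, measure_empty]

lemma volume_real_image_closedUnitTriangle (a b : Plane) :
    volume.real (columnMap a b '' closedUnitTriangle) = |cross a b| / 2 := by
  rw [measureReal_def, Measure.addHaar_image_linearMap, det_columnMap, volume_closedUnitTriangle,
    ← ENNReal.ofReal_mul (abs_nonneg _), ENNReal.toReal_ofReal (by positivity)]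
  ring

lemma volume_real_image_openUnitTriangle (a b : Plane) :
    volume.real (columnMap a b '' openUnitTriangle) = |cross a b| / 2 := by
  rw [measureReal_def, Measure.addHaar_image_linearMap, det_columnMap, volume_openUnitTriangle,
    ← ENNReal.ofReal_mul (abs_nonneg _), ENNReal.toReal_ofReal (by positivity)]
  ring

/-! ### Equilateral frames -/

/-- Three unit vectors with sum zero: the outer normals of an equilateral triangle. -/
structure IsFrame (v : Fin 3 → Plane) : Prop where
  norm_eq : ∀ i, ‖v i‖ = 1
  sum_eq : v 0 + v 1 + v 2 = 0

namespace IsFrame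

variable {v : Fin 3 → Plane}

lemma sum_inner (hv : IsFrame v) (y : Plane) :
    inner ℝ (v 0) y + inner ℝ (v 1) y + inner ℝ (v 2) y = 0 := by
  rw [← inner_add_left, ← inner_add_left, hv.sum_eq, inner_zero_left]

lemma inner_self (hv : IsFrame v) (i : Fin 3) : inner ℝ (v i) (v i) = (1 : ℝ) := by
  rw [real_inner_self_eq_norm_sq, hv.norm_eq]; norm_num

lemma inner_of_ne (hv : IsFrame v) {i j : Fin 3} (h : i ≠ j) : inner ℝ (v i) (v j) = (-1 / 2 : ℝ) := by
  have h0 := hv.sum_inner (v 0)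
  have h1 := hv.sum_inner (v 1)
  have h2 := hv.sum_inner (v 2)
  have a0 := hv.inner_self 0
  have a1 := hv.inner_self 1
  have a2 := hv.inner_self 2
  have c1 := real_inner_comm (v 0) (v 1)
  have c2 := real_inner_comm (v 0) (v 2)
  have c3 := real_inner_comm (v 1) (v 2)
  fin_cases i <;> fin_cases j <;> first | exact absurd rfl h | (simp only [Fin.zero_eta, Fin.mk_one, Fin.reduceFinMk]; linarith)

lemma coord (hv : IsFrame v) :
    v 2 0 = - v 0 0 - v 1 0 ∧ v 2 1 = - v 0 1 - v 1 1 ∧ v 0 0 ^ 2 + v 0 1 ^ 2 = 1 ∧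
      v 1 0 ^ 2 + v 1 1 ^ 2 = 1 ∧ v 0 0 * v 1 0 + v 0 1 * v 1 1 = -1 / 2 := by
  have h0 := congrArg (fun x : Plane => x 0) hv.sum_eq
  have h1 := congrArg (fun x : Plane => x 1) hv.sum_eq
  simp at h0 h1
  have n0 := norm_sq_eq_coord (v 0)
  have n1 := norm_sq_eq_coord (v 1)
  rw [hv.norm_eq] at n0 n1
  have n01 := hv.inner_of_ne (show (0 : Fin 3) ≠ 1 by decide)
  rw [inner_eq_coord] at n01
  exact ⟨by linarith, by linarith, by linarith, by linarith, n01⟩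

lemma cross_sq (hv : IsFrame v) : cross (v 0) (v 1) ^ 2 = 3 / 4 := by
  obtain ⟨-, -, h3, h4, h5⟩ := hv.coord
  have : cross (v 0) (v 1) ^ 2 = (v 0 0 ^ 2 + v 0 1 ^ 2) * (v 1 0 ^ 2 + v 1 1 ^ 2)
    - (v 0 0 * v 1 0 + v 0 1 * v 1 1) ^ 2 := by unfold cross; ring
  rw [this, h3, h4, h5]; norm_num

/-- The tight frame identity. -/
lemma sum_inner_smul (hv : IsFrame v) (y : Plane) :
    inner ℝ (v 0) y • v 0 + inner ℝ (v 1) y • v 1 + inner ℝ (v 2) y • v 2 = (3 / 2 : ℝ) • y := by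
  have hs := hv.cross_sq
  obtain ⟨h1, h2, h3, h4, h5⟩ := hv.coord
  -- The vector `v 1` is expanded in `v 0` and its quarter turn, with coefficients `-1/2` and `σ`,
  -- where `σ² = 3/4`. This covers both orientations of the frame at once.
  have hc : v 1 0 = - v 0 0 / 2 - cross (v 0) (v 1) * v 0 1 := by
    unfold cross; linear_combination v 0 0 * h5 - v 1 0 * h3
  have hd : v 1 1 = - v 0 1 / 2 + cross (v 0) (v 1) * v 0 0 := by
    unfold cross; linear_combination v 0 1 * h5 - v 1 1 * h3
  generalize cross (v 0) (v 1) = σ at *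
  ext i
  fin_cases i
  · simp [inner_eq_coord, h1, h2]
    rw [hc, hd]
    linear_combination (3 / 2 * y 0) * h3 + (2 * v 0 1 ^ 2 * y 0 - 2 * v 0 0 * v 0 1 * y 1) * hs
  · simp [inner_eq_coord, h1, h2]
    rw [hc, hd]
    linear_combination (3 / 2 * y 1) * h3 + (2 * v 0 0 ^ 2 * y 1 - 2 * v 0 0 * v 0 1 * y 0) * hs

lemma sum_inner_sq (hv : IsFrame v) (y : Plane) :
    inner ℝ (v 0) y ^ 2 + inner ℝ (v 1) y ^ 2 + inner ℝ (v 2) y ^ 2 = 3 / 2 * ‖y‖ ^ 2 := by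
  have h := congrArg (fun x => inner ℝ x y) (hv.sum_inner_smul y)
  simp only [inner_add_left, real_inner_smul_left, real_inner_self_eq_norm_sq] at h
  linarith

end IsFrame

/-! ### Widths -/

lemma isCompact_image_inner {K : Set Plane} (hK : IsCompact K) (u : Plane) :
    IsCompact ((fun x : Plane => inner ℝ u x) '' K) :=
  hK.image (by fun_prop)

lemma inner_sub_inner_le_directionalWidth {K : Set Plane} (hK : IsCompact K) (u : Plane)
    {x y : Plane} (hx : x ∈ K) (hy : y ∈ K) :
    inner ℝ u x - inner ℝ u y ≤ directionalWidth K u := by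
  have h := isCompact_image_inner hK u
  exact sub_le_sub (le_csSup h.bddAbove (mem_image_of_mem _ hx))
    (csInf_le h.bddBelow (mem_image_of_mem _ hy))

lemma directionalWidth_le {K : Set Plane} (hne : K.Nonempty) {u : Plane} {m M : ℝ}
    (h : ∀ x ∈ K, m ≤ inner ℝ u x ∧ inner ℝ u x ≤ M) : directionalWidth K u ≤ M - m := by
  refine sub_le_sub (csSup_le (hne.image _) ?_) (le_csInf (hne.image _) ?_)
  · rintro _ ⟨x, hx, rfl⟩; exact (h x hx).2
  · rintro _ ⟨x, hx, rfl⟩; exact (h x hx).1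

lemma minimalWidth_le_directionalWidth {K : Set Plane} (hK : IsCompact K) (hne : K.Nonempty)
    {u : Plane} (hu : ‖u‖ = 1) : minimalWidth K ≤ directionalWidth K u := by
  refine csInf_le ⟨0, ?_⟩ (mem_image_of_mem _ (by simpa using hu))
  rintro _ ⟨u, -, rfl⟩
  obtain ⟨x, hx⟩ := hne
  simpa using inner_sub_inner_le_directionalWidth hK u hx hx

lemma le_minimalWidth {K : Set Plane} {a : ℝ}
    (h : ∀ u : Plane, ‖u‖ = 1 → a ≤ directionalWidth K u) : a ≤ minimalWidth K := by
  refine le_csInf ((NormedSpace.sphere_nonempty.2 zero_le_one).image _) ?_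
  rintro _ ⟨u, hu, rfl⟩
  exact h u (by simpa using hu)

/-- Every convex body has, beyond each of its supporting lines, a point at distance at least the
minimal width. -/
lemma exists_inner_le_sub_minimalWidth {K : Set Plane} (hK : IsCompact K) (hne : K.Nonempty)
    {u : Plane} (hu : ‖u‖ = 1) {M : ℝ} (hM : ∀ x ∈ K, inner ℝ u x ≤ M) :
    ∃ p ∈ K, inner ℝ u p ≤ M - minimalWidth K := by
  obtain ⟨p, hp, hmin⟩ := hK.exists_isMinOn hne
    (f := fun x : Plane => (inner ℝ u x : ℝ)) (by fun_prop)
  refine ⟨p, hp, ?_⟩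
  have h1 := minimalWidth_le_directionalWidth hK hne hu
  have h2 := directionalWidth_le hne (u := u) (m := inner ℝ u p) (M := M)
    fun x hx => ⟨hmin hx, hM x hx⟩
  linarith

lemma minimalWidth_pos {K : Set Plane} (hK : IsCompact K) (hi : (interior K).Nonempty) :
    0 < minimalWidth K := by
  obtain ⟨z, hz⟩ := hi
  obtain ⟨ε, hε, hb⟩ := Metric.isOpen_iff.1 isOpen_interior z hz
  refine lt_of_lt_of_le (half_pos hε) (le_minimalWidth fun u hu => ?_)
  have hmem : z + (ε / 2) • u ∈ K := by
    refine interior_subset (hb ?_)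
    rw [mem_ball, dist_eq_norm, add_sub_cancel_left, norm_smul, hu, Real.norm_of_nonneg (half_pos hε).le]
    linarith
  have := inner_sub_inner_le_directionalWidth hK u hmem (interior_subset hz)
  rw [inner_add_right, real_inner_smul_right, real_inner_self_eq_norm_sq, hu] at this
  linarith

/-! ### Equilateral triangles -/

/-- The triangle with outer normals `v i` whose incircle has center `z` and radius `w / 3`. -/
def tri (v : Fin 3 → Plane) (z : Plane) (w : ℝ) : Set Plane :=
  {x | ∀ i, inner ℝ (v i) (x - z) ≤ w / 3}

/-- The vertices of `tri v z w`. -/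
noncomputable def vertex (v : Fin 3 → Plane) (z : Plane) (w : ℝ) (i : Fin 3) : Plane :=
  z - (2 * w / 3) • v i

lemma tri_mono (v : Fin 3 → Plane) (z : Plane) {w w' : ℝ} (h : w ≤ w') :
    tri v z w ⊆ tri v z w' := fun x hx i => (hx i).trans (by linarith)

lemma isClosed_tri (v : Fin 3 → Plane) (z : Plane) (w : ℝ) : IsClosed (tri v z w) := by
  have : tri v z w = ⋂ i, {x | inner ℝ (v i) (x - z) ≤ w / 3} := by ext; simp [tri]
  rw [this]
  exact isClosed_iInter fun i => isClosed_le (by fun_prop) continuous_const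

lemma convex_tri (v : Fin 3 → Plane) (z : Plane) (w : ℝ) : Convex ℝ (tri v z w) := by
  intro x hx y hy a b ha hb hab i
  have e : a • x + b • y - z = a • (x - z) + b • (y - z) := by
    obtain rfl : b = 1 - a := by linarith
    module
  rw [e, inner_add_right, real_inner_smul_right, real_inner_smul_right]
  have h1 := mul_le_mul_of_nonneg_left (hx i) ha
  have h2 := mul_le_mul_of_nonneg_left (hy i) hb
  calc _ ≤ a * (w / 3) + b * (w / 3) := add_le_add h1 h2
    _ = w / 3 := by rw [← add_mul, hab, one_mul]

lemma mem_tri_iff {v : Fin 3 → Plane} (hv : IsFrame v) (z : Plane) {w : ℝ}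
    (hw : 0 < w) (x : Plane) : x ∈ tri v z w ↔ ∃ a b c : ℝ, 0 ≤ a ∧ 0 ≤ b ∧ 0 ≤ c ∧
    a + b + c = 1 ∧ x = a • vertex v z w 0 + b • vertex v z w 1 + c • vertex v z w 2 := by
  constructor
  · intro hx
    have hs := hv.sum_inner (x - z)
    have ht := hv.sum_inner_smul (x - z)
    -- These are the barycentric coordinates of `x`: distance to the `i`-th side divided by the
    -- altitude `w`.
    have key : ∀ i, 0 ≤ 1 / 3 - inner ℝ (v i) (x - z) / w := fun i => by
      have := div_le_div_of_nonneg_right (hx i) hw.le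
      have e : w / 3 / w = 1 / 3 := by field_simp
      linarith
    refine ⟨_, _, _, key 0, key 1, key 2, ?_, ?_⟩
    · field_simp; linarith
    · simp only [vertex]
      have h2 : v 2 = - v 0 - v 1 := by
        rw [eq_neg_of_add_eq_zero_right hv.sum_eq]; abel
      generalize inner ℝ (v 0) (x - z) = p0 at *
      generalize inner ℝ (v 1) (x - z) = p1 at *
      have e2 : inner ℝ (v 2) (x - z) = - p0 - p1 := by linarith
      rw [e2] at ht ⊢
      have hx : x = z + (2 / 3 : ℝ) • ((3 / 2 : ℝ) • (x - z)) := by module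
      conv_lhs => rw [hx, ← ht, h2]
      rw [h2]
      match_scalars <;> field_simp <;> ring
  · rintro ⟨a, b, c, ha, hb, hc, hs, rfl⟩ i
    have e : a • vertex v z w 0 + b • vertex v z w 1 + c • vertex v z w 2 - z =
        -(2 * w / 3) • (a • v 0 + b • v 1 + c • v 2) := by
      obtain rfl : c = 1 - a - b := by linarith
      simp only [vertex]; module
    rw [e, real_inner_smul_right, inner_add_right, inner_add_right, real_inner_smul_right,
      real_inner_smul_right, real_inner_smul_right]
    have key : ∀ j, -1 / 2 ≤ (inner ℝ (v i) (v j) : ℝ) := fun j => by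
      by_cases h : i = j
      · rw [h, hv.inner_self]; norm_num
      · rw [hv.inner_of_ne h]
    have h0 := mul_le_mul_of_nonneg_left (key 0) ha
    have h1 := mul_le_mul_of_nonneg_left (key 1) hb
    have h2 := mul_le_mul_of_nonneg_left (key 2) hc
    nlinarith

lemma tri_eq_convexHull {v : Fin 3 → Plane} (hv : IsFrame v) (z : Plane) {w : ℝ}
    (hw : 0 < w) : tri v z w = convexHull ℝ (range (vertex v z w)) := by
  have hm : ∀ i, vertex v z w i ∈ convexHull ℝ (range (vertex v z w)) := fun i =>
    subset_convexHull _ _ (mem_range_self i)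
  ext x
  rw [mem_tri_iff hv z hw]
  constructor
  · rintro ⟨a, b, c, ha, hb, hc, hs, rfl⟩
    have hconv := convex_convexHull ℝ (range (vertex v z w))
    have := hconv.sum_mem (t := Finset.univ) (w := ![a, b, c]) (z := vertex v z w)
      (by intro i _; fin_cases i <;> simpa) (by simpa [Fin.sum_univ_three] using hs)
      (fun i _ => hm i)
    simpa [Fin.sum_univ_three] using this
  · intro hx
    rw [← mem_tri_iff hv z hw]
    refine convexHull_min ?_ (convex_tri v z w) hx
    rintro _ ⟨i, rfl⟩
    rw [mem_tri_iff hv z hw]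
    fin_cases i
    · exact ⟨1, 0, 0, by simp⟩
    · exact ⟨0, 1, 0, by simp⟩
    · exact ⟨0, 0, 1, by simp⟩

lemma volume_real_tri {v : Fin 3 → Plane} (hv : IsFrame v) (z : Plane) {w : ℝ}
    (hw : 0 < w) : volume.real (tri v z w) = w ^ 2 / √3 := by
  set A := vertex v z w with hA
  have : tri v z w = (fun x => -A 0 + x) ⁻¹'
      (columnMap (A 1 - A 0) (A 2 - A 0) '' closedUnitTriangle) := by
    ext x
    rw [mem_tri_iff hv z hw]
    constructor
    · rintro ⟨a, b, c, ha, hb, hc, hs, rfl⟩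
      refine ⟨!₂[b, c], ⟨by simpa, by simpa, ?_⟩, ?_⟩
      · simp; linarith
      · obtain rfl : a = 1 - b - c := by linarith
        simp [columnMap]; module
    · rintro ⟨y, ⟨h0, h1, h2⟩, hy⟩
      refine ⟨1 - y 0 - y 1, y 0, y 1, by linarith, h0, h1, by ring, ?_⟩
      have : x = A 0 + (columnMap (A 1 - A 0) (A 2 - A 0)) y := by rw [hy]; module
      rw [this]
      simp [columnMap]; module
  rw [this, measureReal_def, measure_preimage_add, ← measureReal_def,
    volume_real_image_closedUnitTriangle]
  have hc : cross (A 1 - A 0) (A 2 - A 0) = (4 * w ^ 2 / 3) * cross (v 0) (v 1) := by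
    obtain ⟨h1, h2, -, -, -⟩ := hv.coord
    simp only [hA, cross, vertex, PiLp.sub_apply, PiLp.smul_apply, smul_eq_mul, h1, h2]
    ring
  have habs : |cross (v 0) (v 1)| = √3 / 2 := by
    rw [← Real.sqrt_sq_eq_abs, hv.cross_sq, Real.sqrt_div (by norm_num)]
    congr 1
    rw [show (4 : ℝ) = 2 ^ 2 by norm_num, Real.sqrt_sq (by norm_num)]
  rw [hc, abs_mul, habs, abs_of_pos (by positivity)]
  have : √3 ^ 2 = 3 := Real.sq_sqrt (by norm_num)
  field_simp
  rw [this]; ring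

lemma isCompact_tri {v : Fin 3 → Plane} (hv : IsFrame v) (z : Plane) {w : ℝ}
    (hw : 0 < w) : IsCompact (tri v z w) := by
  rw [tri_eq_convexHull hv z hw]
  exact (finite_range _).isCompact_convexHull ℝ

lemma vertex_mem_tri {v : Fin 3 → Plane} (hv : IsFrame v) (z : Plane) {w : ℝ}
    (hw : 0 < w) (i : Fin 3) : vertex v z w i ∈ tri v z w := by
  rw [tri_eq_convexHull hv z hw]
  exact subset_convexHull _ _ (mem_range_self i)

/-- Three numbers with sum `0` and spread `s` have square sum at most `2s² / 3`. Here the square sum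
is `3/2`. This is what bounds every directional width of `tri v z w` below by `w`. -/
lemma exists_inner_sub_inner_ge {v : Fin 3 → Plane} (hv : IsFrame v) {u : Plane} (hu : ‖u‖ = 1) :
    ∃ i j, 3 / 2 ≤ inner ℝ (v i) u - inner ℝ (v j) u := by
  have h1 := hv.sum_inner u
  have h2 := hv.sum_inner_sq u
  rw [hu] at h2
  by_contra! h
  have h01 := h 0 1
  have h10 := h 1 0
  have h02 := h 0 2
  have h20 := h 2 0
  have h12 := h 1 2
  have h21 := h 2 1
  generalize (inner ℝ (v 0) u : ℝ) = a at *
  generalize (inner ℝ (v 1) u : ℝ) = b at *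
  generalize (inner ℝ (v 2) u : ℝ) = c at *
  obtain rfl : c = - a - b := by linarith
  rcases le_total a b with hab | hab <;> rcases le_total b (-a - b) with hbc | hbc <;>
    rcases le_total a (-a - b) with hac | hac <;> nlinarith

lemma minimalWidth_tri {v : Fin 3 → Plane} (hv : IsFrame v) (z : Plane) {w : ℝ}
    (hw : 0 < w) : minimalWidth (tri v z w) = w := by
  have hcomp := isCompact_tri hv z hw
  have hne : (tri v z w).Nonempty := ⟨_, vertex_mem_tri hv z hw 0⟩
  apply le_antisymm
  · refine (minimalWidth_le_directionalWidth hcomp hne (hv.norm_eq 0)).trans ?_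
    have := directionalWidth_le hne (u := v 0) (m := inner ℝ (v 0) z - 2 * w / 3)
      (M := inner ℝ (v 0) z + w / 3) (fun x hx => by
        have hs := hv.sum_inner (x - z)
        have h0 := hx 0
        have h1 := hx 1
        have h2 := hx 2
        rw [inner_sub_right] at hs h0
        constructor <;> linarith)
    linarith
  · refine le_minimalWidth fun u hu => ?_
    obtain ⟨i, j, hij⟩ := exists_inner_sub_inner_ge hv hu
    have := inner_sub_inner_le_directionalWidth hcomp u (vertex_mem_tri hv z hw j)
      (vertex_mem_tri hv z hw i)
    simp only [vertex, inner_sub_right, real_inner_smul_right] at this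
    rw [real_inner_comm, real_inner_comm u] at hij
    nlinarith

lemma isEquilateralTriangle_tri {v : Fin 3 → Plane} (hv : IsFrame v) (z : Plane) {w : ℝ}
    (hw : 0 < w) : IsEquilateralTriangle (tri v z w) := by
  have hdist : ∀ i j, i ≠ j → dist (vertex v z w i) (vertex v z w j) = 2 * w / 3 * √3 := by
    intro i j hij
    have hn : ‖v j - v i‖ = √3 := by
      rw [eq_comm, Real.sqrt_eq_iff_mul_self_eq (by norm_num) (norm_nonneg _), ← sq,
        norm_sub_sq_real, hv.norm_eq, hv.norm_eq, hv.inner_of_ne hij.symm]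
      norm_num
    rw [dist_eq_norm, show vertex v z w i - vertex v z w j = (2 * w / 3) • (v j - v i) by
      simp only [vertex]; module, norm_smul, hn, Real.norm_of_nonneg (by positivity)]
  have hind : AffineIndependent ℝ (vertex v z w) := by
    rw [affineIndependent_iff_of_fintype]
    intro c hc h
    rw [Finset.weightedVSub_eq_weightedVSubOfPoint_of_sum_eq_zero _ _ _ hc z,
      Finset.weightedVSubOfPoint_apply] at h
    simp only [Fin.sum_univ_three, vertex, vsub_eq_sub] at h hc
    have h' : c 0 • v 0 + c 1 • v 1 + c 2 • v 2 = 0 := by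
      have hw' : (-(2 * w / 3)) ≠ 0 := by linarith
      refine (smul_eq_zero_iff_right hw').1 ?_
      rw [← h]; module
    intro i
    have := congrArg (fun x => inner ℝ (v i) x) h'
    simp only [inner_add_right, real_inner_smul_right, inner_zero_right] at this
    fin_cases i
    · have a := hv.inner_self 0
      have b := hv.inner_of_ne (show (0 : Fin 3) ≠ 1 by decide)
      have d := hv.inner_of_ne (show (0 : Fin 3) ≠ 2 by decide)
      simp only [Fin.zero_eta, a, b, d] at this ⊢
      linarith
    · have a := hv.inner_self 1
      have b := hv.inner_of_ne (show (1 : Fin 3) ≠ 0 by decide)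
      have d := hv.inner_of_ne (show (1 : Fin 3) ≠ 2 by decide)
      simp only [Fin.mk_one, a, b, d] at this ⊢
      linarith
    · have a := hv.inner_self 2
      have b := hv.inner_of_ne (show (2 : Fin 3) ≠ 0 by decide)
      have d := hv.inner_of_ne (show (2 : Fin 3) ≠ 1 by decide)
      simp only [Fin.reduceFinMk, a, b, d] at this ⊢
      linarith
  exact ⟨⟨vertex v z w, hind⟩, ⟨_, hdist⟩, tri_eq_convexHull hv z hw⟩

lemma norm_sub_centroid {p q s : Plane} {r : ℝ} (hr : 0 ≤ r) (h1 : dist p q = r) (h2 : dist p s = r)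
    (h3 : dist q s = r) : ‖p - (1 / 3 : ℝ) • (p + q + s)‖ = r / √3 := by
  have e : p - (1 / 3 : ℝ) • (p + q + s) = (1 / 3 : ℝ) • ((p - q) + (p - s)) := by module
  rw [dist_eq_norm] at h1 h2 h3
  have h4 : q - s = (p - s) - (p - q) := by abel
  have h5 := norm_sub_sq_real (p - s) (p - q)
  rw [← h4, h1, h2, h3] at h5
  have h6 := norm_add_sq_real (p - q) (p - s)
  rw [real_inner_comm, h1, h2] at h6
  have h7 : ‖(p - q) + (p - s)‖ = √3 * r := by
    rw [← Real.sqrt_sq (norm_nonneg (p - q + (p - s))), h6,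
      show r ^ 2 + 2 * inner ℝ (p - s) (p - q) + r ^ 2 = 3 * r ^ 2 by linarith,
      Real.sqrt_mul (by norm_num), Real.sqrt_sq hr]
  rw [e, norm_smul, h7, Real.norm_of_nonneg (by norm_num)]
  have : √3 ^ 2 = 3 := Real.sq_sqrt (by norm_num)
  field_simp
  rw [this]

lemma exists_eq_tri {E : Set Plane} (hE : IsEquilateralTriangle E) :
    ∃ v z, IsFrame v ∧ 0 < minimalWidth E ∧ E = tri v z (minimalWidth E) := by
  obtain ⟨t, ⟨r, hr⟩, rfl⟩ := hE
  have hrpos : 0 < r := by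
    rw [← hr 0 1 (by decide)]
    exact dist_pos.2 fun h => absurd (t.independent.injective h) (by decide)
  set A := t.points
  set z : Plane := (1 / 3 : ℝ) • (A 0 + A 1 + A 2) with hz
  have hs3 : √3 ^ 2 = 3 := Real.sq_sqrt (by norm_num)
  have hn : ∀ i, ‖A i - z‖ = r / √3 := by
    intro i
    fin_cases i
    · exact norm_sub_centroid hrpos.le (hr 0 1 (by decide)) (hr 0 2 (by decide))
        (hr 1 2 (by decide))
    · have := norm_sub_centroid hrpos.le (hr 1 0 (by decide)) (hr 1 2 (by decide))
        (hr 0 2 (by decide))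
      rwa [add_comm (A 1)] at this
    · have := norm_sub_centroid hrpos.le (hr 2 0 (by decide)) (hr 2 1 (by decide))
        (hr 0 1 (by decide))
      rwa [show A 2 + A 0 + A 1 = A 0 + A 1 + A 2 by abel] at this
  -- The unit vector from a vertex towards the centroid is the outer normal of the opposite side.
  -- The altitude is `r * √3 / 2` for side length `r`.
  have hv : IsFrame fun i => -(√3 / r) • (A i - z) := by
    constructor
    · intro i
      rw [norm_smul, hn, norm_neg, Real.norm_of_nonneg (by positivity)]
      field_simp
    · rw [hz]; module
  have hw : 0 < r * √3 / 2 := by positivity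
  have hvert : vertex (fun i => -(√3 / r) • (A i - z)) z (r * √3 / 2) = A := by
    funext i
    simp only [vertex, smul_smul]
    rw [show 2 * (r * √3 / 2) / 3 * -(√3 / r) = -1 by field_simp; linarith]
    module
  have heq := tri_eq_convexHull hv z hw
  rw [hvert] at heq
  have hmw := minimalWidth_tri hv z hw
  rw [← heq, hmw]
  exact ⟨_, _, hv, hw, rfl⟩

/-! ### The best approximating equilateral triangle -/

/-- The frame determined by an orthonormal pair. -/
noncomputable def pairFrame (e q : Plane) : Fin 3 → Plane :=
  ![e, (-1 / 2 : ℝ) • e + (√3 / 2) • q, (-1 / 2 : ℝ) • e - (√3 / 2) • q]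

lemma norm_sq_pair {e q : Plane} (he : ‖e‖ = 1) (hq : ‖q‖ = 1) (heq : inner ℝ e q = (0 : ℝ))
    (a b : ℝ) : ‖a • e + b • q‖ ^ 2 = a ^ 2 + b ^ 2 := by
  rw [norm_add_sq_real, norm_smul, norm_smul, he, hq, real_inner_smul_left,
    real_inner_smul_right, heq]
  simp

lemma isFrame_pairFrame {e q : Plane} (he : ‖e‖ = 1) (hq : ‖q‖ = 1)
    (heq : inner ℝ e q = (0 : ℝ)) : IsFrame (pairFrame e q) := by
  have h3 : √3 ^ 2 = 3 := Real.sq_sqrt (by norm_num)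
  refine ⟨fun i => ?_, ?_⟩
  · fin_cases i
    · exact he
    · have := norm_sq_pair he hq heq (-1 / 2) (√3 / 2)
      rw [div_pow √3, h3] at this
      have h : ‖(-1 / 2 : ℝ) • e + (√3 / 2) • q‖ ^ 2 = 1 ^ 2 := by rw [this]; norm_num
      exact (sq_eq_sq₀ (norm_nonneg _) zero_le_one).1 h
    · have := norm_sq_pair he hq heq (-1 / 2) (-(√3 / 2))
      rw [neg_sq, div_pow √3, h3, neg_smul, ← sub_eq_add_neg] at this
      have h : ‖(-1 / 2 : ℝ) • e - (√3 / 2) • q‖ ^ 2 = 1 ^ 2 := by rw [this]; norm_num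
      exact (sq_eq_sq₀ (norm_nonneg _) zero_le_one).1 h
  · simp only [pairFrame, Matrix.cons_val_zero, Matrix.cons_val_one, Matrix.cons_val]
    module

/-- Rotation of the plane by a right angle. -/
def perp (x : Plane) : Plane := !₂[-x 1, x 0]

lemma norm_perp (x : Plane) : ‖perp x‖ = ‖x‖ := by
  rw [← sq_eq_sq₀ (norm_nonneg _) (norm_nonneg _), norm_sq_eq_coord, norm_sq_eq_coord]
  simp [perp]; ring

lemma inner_perp (x : Plane) : inner ℝ x (perp x) = (0 : ℝ) := by
  simp [inner_eq_coord, perp]; ring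

lemma exists_isFrame {e : Plane} (he : ‖e‖ = 1) : ∃ v, IsFrame v ∧ v 0 = e :=
  ⟨_, isFrame_pairFrame he ((norm_perp e).trans he) (inner_perp e), rfl⟩

/-- The circumradius of an equilateral triangle is twice its inradius. Adding the three products `(m
- a) * (m - b) ≥ 0` and using `sum_inner_sq` gives `3m² ≥ 3‖y‖² / 4`. -/
lemma IsFrame.norm_le_of_inner_le {v : Fin 3 → Plane} (hv : IsFrame v) {y : Plane} {m : ℝ}
    (h : ∀ i, inner ℝ (v i) y ≤ m) : ‖y‖ ≤ 2 * m := by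
  have h0 := h 0
  have h1 := h 1
  have h2 := h 2
  have hs := hv.sum_inner y
  have hq := hv.sum_inner_sq y
  generalize (inner ℝ (v 0) y : ℝ) = a at *
  generalize (inner ℝ (v 1) y : ℝ) = b at *
  generalize (inner ℝ (v 2) y : ℝ) = c at *
  have hm : 0 ≤ m := by linarith
  refine abs_le_of_sq_le_sq' ?_ (by positivity) |>.2
  have e1 := mul_nonneg (sub_nonneg.2 h0) (sub_nonneg.2 h1)
  have e2 := mul_nonneg (sub_nonneg.2 h0) (sub_nonneg.2 h2)
  have e3 := mul_nonneg (sub_nonneg.2 h1) (sub_nonneg.2 h2)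
  obtain rfl : c = - a - b := by linarith
  nlinarith

lemma tri_subset_closedBall {v : Fin 3 → Plane} (hv : IsFrame v) (z : Plane) (w : ℝ) :
    tri v z w ⊆ closedBall z (2 * w / 3) := fun x hx => by
  rw [mem_closedBall, dist_eq_norm]
  have := hv.norm_le_of_inner_le hx
  linarith

lemma isCompact_setOf_isFrame : IsCompact {v : Fin 3 → Plane | IsFrame v} := by
  have e : {v : Fin 3 → Plane | IsFrame v} =
      {v | v 0 + v 1 + v 2 = 0} ∩ Set.pi univ fun _ => sphere 0 1 := by
    ext v
    simp only [mem_ofPred_eq, mem_inter_iff, mem_pi, mem_univ, forall_const, mem_sphere_zero_iff_norm]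
    exact ⟨fun h => ⟨h.2, h.1⟩, fun h => ⟨h.2, h.1⟩⟩
  rw [e]
  exact (isCompact_univ_pi fun _ => isCompact_sphere _ _).inter_left
    (isClosed_eq (by fun_prop) continuous_const)

/-- A nearby triangle meets `K` only inside a slight enlargement of the given one, and the area of
the added margin is explicit and tends to zero. -/
lemma upperSemicontinuousOn_overlap {K : Set Plane} (hK : IsCompact K) {w : ℝ} (hw : 0 < w)
    (S : Set Plane) :
    UpperSemicontinuousOn (fun p : (Fin 3 → Plane) × Plane => volume.real (K ∩ tri p.1 p.2 w))
      ({v : Fin 3 → Plane | IsFrame v} ×ˢ S) := by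
  obtain ⟨B, hB⟩ := hK.isBounded.exists_norm_le
  rintro ⟨v, z⟩ ⟨hv, -⟩ c hc
  have hv' : IsFrame v := hv
  -- Perturbing normals and center moves the constraints on points of `K` by at most `t p / 3`. The
  -- factor `3` compensates for the `w / 3` in `tri`.
  set t : (Fin 3 → Plane) × Plane → ℝ := fun p =>
    3 * (‖v - p.1‖ * (|B| + ‖z‖) + ‖p.2 - z‖) with ht
  have htc : Continuous t := by fun_prop
  have hg : Continuous fun p => volume.real (K ∩ tri v z w) + ((w + t p) ^ 2 / √3 - w ^ 2 / √3) := by fun_prop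
  have hlt : volume.real (K ∩ tri v z w) + ((w + t (v, z)) ^ 2 / √3 - w ^ 2 / √3) < c := by
    simpa [ht] using hc
  have hev := hg.continuousAt.eventually_lt continuousAt_const hlt
  filter_upwards [hev.filter_mono nhdsWithin_le_nhds, self_mem_nhdsWithin] with p hp hpS
  refine lt_of_le_of_lt ?_ hp
  have hp1 : IsFrame p.1 := hpS.1
  have htnn : 0 ≤ t p := by positivity
  have hsub : K ∩ tri p.1 p.2 w ⊆ (K ∩ tri v z w) ∪ (tri v z (w + t p) \ tri v z w) := by
    rintro x ⟨hxK, hx⟩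
    have hx' : x ∈ tri v z (w + t p) := by
      intro i
      have e : inner ℝ (v i) (x - z) = inner ℝ (p.1 i) (x - p.2) +
          inner ℝ (v i - p.1 i) (x - z) + inner ℝ (p.1 i) (p.2 - z) := by
        simp only [inner_sub_left, inner_sub_right]; ring
      have h1 := hx i
      have h2 : inner ℝ (v i - p.1 i) (x - z) ≤ ‖v - p.1‖ * (|B| + ‖z‖) := by
        refine (real_inner_le_norm _ _).trans (mul_le_mul (norm_le_pi_norm (v - p.1) i) ?_
          (norm_nonneg _) (norm_nonneg _))
        exact (norm_sub_le _ _).trans (add_le_add ((hB x hxK).trans (le_abs_self B)) le_rfl)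
      have h3 : inner ℝ (p.1 i) (p.2 - z) ≤ ‖p.2 - z‖ := by
        refine (real_inner_le_norm _ _).trans ?_
        rw [hp1.norm_eq, one_mul]
      rw [e]
      simp only [ht]
      linarith
    by_cases h : x ∈ tri v z w
    · exact Or.inl ⟨hxK, h⟩
    · exact Or.inr ⟨hx', h⟩
  have hfin : volume (tri v z (w + t p)) ≠ ⊤ :=
    (isCompact_tri hv' z (by linarith)).measure_ne_top
  have hfin' : volume (K ∩ tri v z w) ≠ ⊤ :=
    measure_ne_top_of_subset inter_subset_left hK.measure_ne_top
  have hd : volume.real (tri v z (w + t p) \ tri v z w) = (w + t p) ^ 2 / √3 - w ^ 2 / √3 := by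
    rw [measureReal_sdiff (tri_mono v z (by linarith)) (isClosed_tri v z w).measurableSet hfin,
      volume_real_tri hv' z hw, volume_real_tri hv' z (by linarith)]
  rw [← hd]
  refine (measureReal_mono hsub ?_).trans (measureReal_union_le _ _)
  exact measure_union_ne_top hfin' (measure_ne_top_of_subset sdiff_subset hfin)

lemma exists_maximal_overlap {K : Set Plane} (hK : IsCompact K) {w : ℝ} (hw : 0 < w) :
    ∃ v z, IsFrame v ∧ ∀ v' z', IsFrame v' →
      volume.real (K ∩ tri v' z' w) ≤ volume.real (K ∩ tri v z w) := by
  obtain ⟨B, hB⟩ := hK.isBounded.exists_norm_le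
  -- A triangle has circumradius `2 * w / 3`, so it misses `K` if its center is farther than `R`
  -- from the origin.
  obtain ⟨R, hR⟩ : ∃ R, R = |B| + 2 * w / 3 := ⟨_, rfl⟩
  have hR0 : 0 ≤ R := by rw [hR]; positivity
  obtain ⟨v₁, hv₁, -⟩ := exists_isFrame (e := EuclideanSpace.single 0 1) (by simp)
  have hne : ({v : Fin 3 → Plane | IsFrame v} ×ˢ closedBall (0 : Plane) R).Nonempty :=
    ⟨(v₁, 0), mk_mem_prod hv₁ (by simpa using hR0)⟩
  obtain ⟨⟨v, z⟩, hvz, hmax⟩ := UpperSemicontinuousOn.exists_isMaxOn hne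
    (isCompact_setOf_isFrame.prod (isCompact_closedBall _ _))
    (upperSemicontinuousOn_overlap hK hw _)
  refine ⟨v, z, hvz.1, fun v' z' hv' => ?_⟩
  by_cases hz : z' ∈ closedBall (0 : Plane) R
  · exact isMaxOn_iff.1 hmax (v', z') (mk_mem_prod hv' hz)
  · have : K ∩ tri v' z' w = ∅ := by
      refine eq_empty_of_forall_notMem fun x hx => hz ?_
      have h1 := tri_subset_closedBall hv' z' w hx.2
      have h2 := (hB x hx.1).trans (le_abs_self B)
      rw [mem_closedBall, dist_comm, dist_eq_norm] at h1
      rw [mem_closedBall_zero_iff]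
      have := norm_le_norm_add_norm_sub' z' x
      linarith
    rw [this]; simp

lemma measureReal_symmDiff_of_isCompact {K E : Set Plane} (hK : IsCompact K) (hE : IsCompact E) :
    volume.real (K ∆ E) = volume.real K + volume.real E - 2 * volume.real (K ∩ E) := by
  rw [measureReal_symmDiff_eq hK.measurableSet hE.measurableSet
    (h₁ := hK.measure_ne_top) (h₂ := hE.measure_ne_top)]
  have h1 := measureReal_inter_add_sdiff (s := K) hE.measurableSet (hK.measure_ne_top (μ := volume))
  have h2 := measureReal_inter_add_sdiff (s := E) hK.measurableSet (hE.measure_ne_top (μ := volume))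
  rw [inter_comm] at h2
  linarith

lemma tri_mem_asymmetryValues {K : Set Plane} (hw : 0 < minimalWidth K) {v : Fin 3 → Plane}
    (hv : IsFrame v) (z : Plane) :
    volume.real (K ∆ tri v z (minimalWidth K)) / minimalWidth K ^ 2 ∈ asymmetryValues K := by
  have h := minimalWidth_tri hv z hw
  exact ⟨_, isEquilateralTriangle_tri hv z hw, h, by rw [h]⟩

theorem isLeast_fraenkelAsymmetry {K : Set Plane} (hK : IsCompact K) (hw : 0 < minimalWidth K) :
    IsLeast (asymmetryValues K) (fraenkelAsymmetry K) := by
  obtain ⟨v, z, hv, hmax⟩ := exists_maximal_overlap hK hw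
  suffices h : IsLeast (asymmetryValues K)
      (volume.real (K ∆ tri v z (minimalWidth K)) / minimalWidth K ^ 2) by
    rwa [fraenkelAsymmetry, h.csInf_eq]
  refine ⟨tri_mem_asymmetryValues hw hv z, ?_⟩
  rintro _ ⟨E, hE, hwE, rfl⟩
  obtain ⟨v', z', hv', -, hE'⟩ := exists_eq_tri hE
  rw [hwE] at hE' ⊢
  rw [hE', measureReal_symmDiff_of_isCompact hK (isCompact_tri hv z hw),
    measureReal_symmDiff_of_isCompact hK (isCompact_tri hv' z' hw), volume_real_tri hv z hw,
    volume_real_tri hv' z' hw]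
  have := hmax v' z' hv'
  gcongr

/-! ### The incircle and its contact points -/

lemma card_le_three_of_affineIndependent {ι : Type*} [Fintype ι] {u : ι → Plane}
    (hu : AffineIndependent ℝ u) : Fintype.card ι ≤ 3 := by
  have h1 := hu.card_le_finrank_succ
  have h2 := Submodule.finrank_le (vectorSpan ℝ (Set.range u))
  rw [finrank_euclideanSpace, Fintype.card_fin] at h2
  omega

/-- By Carathéodory the hull is a finite union of continuous images of compact sets. The index `Fin
4` stands for the numbers `0` to `3` of points needed in the plane. -/
lemma isCompact_convexHull_of_isCompact {N : Set Plane} (hN : IsCompact N) :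
    IsCompact (convexHull ℝ N) := by
  have e : convexHull ℝ N = ⋃ n : Fin 4,
      (fun p : (Fin n → ℝ) × (Fin n → Plane) => ∑ i, p.1 i • p.2 i) ''
        (stdSimplex ℝ (Fin n) ×ˢ Set.pi univ fun _ => N) := by
    ext x
    simp only [mem_iUnion]
    constructor
    · intro hx
      obtain ⟨ι, _, z, w, hz, hind, hw, hsum, rfl⟩ := eq_pos_convex_span_of_mem_convexHull hx
      have hcard := card_le_three_of_affineIndependent hind
      have e := (Fintype.equivFin ι).symm
      refine ⟨⟨Fintype.card ι, by omega⟩, (w ∘ e, z ∘ e), ⟨⟨fun i => (hw _).le, ?_⟩, ?_⟩, ?_⟩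
      · rw [← hsum]; exact e.sum_comp w
      · exact fun i _ => hz (mem_range_self _)
      · exact e.sum_comp fun i => w i • z i
    · rintro ⟨n, ⟨w, z⟩, ⟨hw, hz⟩, rfl⟩
      exact (convex_convexHull ℝ N).sum_mem (fun i _ => hw.1 i) hw.2
        fun i _ => subset_convexHull _ _ (hz i (mem_univ i))
  rw [e]
  exact isCompact_iUnion fun n =>
    ((isCompact_stdSimplex ℝ _).prod (isCompact_univ_pi fun _ => hN)).image (by fun_prop)

/-- The outer unit normals of the supporting lines of `K` that touch the disc with center `z` and
radius `r`. -/
def contactNormals (K : Set Plane) (z : Plane) (r : ℝ) : Set Plane :=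
  {u | ‖u‖ = 1 ∧ ∀ x ∈ K, inner ℝ u (x - z) ≤ r}

/-- A functional supporting `K` at the boundary point `z + r • u` is also maximal there over the
disc. Equality in Cauchy–Schwarz then makes it a positive multiple of `u`. -/
lemma mem_contactNormals_of_notMem_interior {K : Set Plane} (hK : Convex ℝ K)
    {z : Plane} {r : ℝ} (hr : 0 < r) (hb : closedBall z r ⊆ K) {u : Plane} (hu : ‖u‖ = 1)
    (hz : z + r • u ∉ interior K) : u ∈ contactNormals K z r := by
  have hne : (interior K).Nonempty :=
    ⟨z, interior_mono hb (ball_subset_interior_closedBall (mem_ball_self hr))⟩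
  obtain ⟨f, hf⟩ := geometric_hahn_banach_open_point hK.interior isOpen_interior hz
  set g := (InnerProductSpace.toDual ℝ Plane).symm f with hg
  have hfg : ∀ x, f x = inner ℝ g x := fun x => by
    rw [hg, InnerProductSpace.toDual_symm_apply]
  have hle : ∀ x ∈ K, inner ℝ g x ≤ inner ℝ g (z + r • u) := by
    intro x hx
    rw [← hfg, ← hfg]
    have hx' : x ∈ closure (interior K) := by
      rw [hK.closure_interior_eq_closure_of_nonempty_interior hne]
      exact subset_closure hx
    exact le_on_closure (fun y hy => (hf y hy).le) f.continuous.continuousOn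
      continuousOn_const hx'
  have hg0 : 0 < ‖g‖ := by
    rw [norm_pos_iff]
    rintro h
    obtain ⟨y, hy⟩ := hne
    have := hf y hy
    rw [hfg, hfg, h] at this
    simp at this
  have h1 := hle (z + (r / ‖g‖) • g) (hb (by
    rw [mem_closedBall, dist_eq_norm, add_sub_cancel_left, norm_smul,
      Real.norm_of_nonneg (by positivity)]
    field_simp
    exact le_rfl))
  have h2 : inner ℝ g u = ‖g‖ * ‖u‖ := by
    refine le_antisymm (real_inner_le_norm _ _) ?_
    rw [inner_add_right, inner_add_right, real_inner_smul_right, real_inner_smul_right,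
      real_inner_self_eq_norm_sq] at h1
    have h3 : r / ‖g‖ * ‖g‖ ^ 2 = r * ‖g‖ := by field_simp
    rw [h3] at h1
    rw [hu, mul_one]
    nlinarith
  have h3 : g = ‖g‖ • u := by
    have := inner_eq_norm_mul_iff_real.1 h2
    rwa [hu, one_smul] at this
  refine ⟨hu, fun x hx => ?_⟩
  have h4 := hle x hx
  rw [h3, real_inner_smul_left, real_inner_smul_left] at h4
  have h5 := le_of_mul_le_mul_left h4 hg0
  rw [inner_add_right, real_inner_smul_right, real_inner_self_eq_norm_sq, hu] at h5
  rw [inner_sub_right]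
  linarith

/-- A disc in `K` whose points of contact with the boundary lie in an open half-plane can be moved
into the interior. -/
lemma exists_closedBall_subset_interior {K : Set Plane} {z : Plane} {r : ℝ} (hr : 0 < r)
    (hb : closedBall z r ⊆ K) {g : Plane} {c : ℝ} (hc : 0 < c)
    (hg : ∀ u : Plane, ‖u‖ = 1 → z + r • u ∉ interior K → c < inner ℝ g u) :
    ∃ z', closedBall z' r ⊆ interior K := by
  have hball : ball z r ⊆ interior K :=
    ball_subset_interior_closedBall.trans (interior_mono hb)
  -- The disc is moved by `-t • g` and split in two. The part `S`, away from the contact points, is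
  -- a compact subset of the interior and tolerates a small shift. On the rest `inner ℝ g s` exceeds
  -- `r * c / 2`, so the shift brings points strictly closer to `z`.
  set S : Set Plane := (fun s => z + s) '' (closedBall 0 r ∩ {s | inner ℝ g s ≤ r * c / 2})
  have hS : IsCompact S :=
    ((isCompact_closedBall _ _).inter_right
      (isClosed_le (by fun_prop) continuous_const)).image (by fun_prop)
  have hSK : S ⊆ interior K := by
    rintro _ ⟨s, ⟨hs1, hs2⟩, rfl⟩
    rw [mem_closedBall_zero_iff] at hs1
    rcases hs1.lt_or_eq with h | h
    · exact hball (by simpa using h)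
    · by_contra hn
      have hs3 : s = r • (r⁻¹ • s) := by rw [smul_smul, mul_inv_cancel₀ hr.ne', one_smul]
      have hs4 : ‖r⁻¹ • s‖ = 1 := by
        rw [norm_smul, h, Real.norm_of_nonneg (by positivity), inv_mul_cancel₀ hr.ne']
      have h5 := hg (r⁻¹ • s) hs4 (by rwa [← hs3])
      have h6 : inner ℝ g s = r * inner ℝ g (r⁻¹ • s) := by
        conv_lhs => rw [hs3, real_inner_smul_right]
      have h7 : (inner ℝ g s : ℝ) ≤ r * c / 2 := hs2
      nlinarith [mul_pos hr hc]
  obtain ⟨δ, hδ, hthick⟩ := hS.exists_thickening_subset_open isOpen_interior hSK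
  obtain ⟨t, ht, ht1, ht2⟩ : ∃ t : ℝ, 0 < t ∧ t * ‖g‖ < δ ∧ t * ‖g‖ ^ 2 < r * c := by
    refine ⟨min (δ / (‖g‖ + 1)) (r * c / (‖g‖ ^ 2 + 1)), by positivity, ?_, ?_⟩
    · calc _ ≤ δ / (‖g‖ + 1) * ‖g‖ := by gcongr; exact min_le_left _ _
        _ < δ / (‖g‖ + 1) * (‖g‖ + 1) := by gcongr; linarith
        _ = δ := by field_simp
    · calc _ ≤ r * c / (‖g‖ ^ 2 + 1) * ‖g‖ ^ 2 := by gcongr; exact min_le_right _ _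
        _ < r * c / (‖g‖ ^ 2 + 1) * (‖g‖ ^ 2 + 1) := by gcongr; linarith
        _ = r * c := by field_simp
  refine ⟨z - t • g, fun y hy => ?_⟩
  obtain ⟨s, rfl⟩ : ∃ s, y = z + s - t • g := ⟨y - z + t • g, by abel⟩
  have hs : ‖s‖ ≤ r := by
    rw [mem_closedBall, dist_eq_norm] at hy
    rwa [show z + s - t • g - (z - t • g) = s by abel] at hy
  by_cases h : inner ℝ g s ≤ r * c / 2
  · refine hthick (mem_thickening_iff.2 ⟨z + s, ⟨s, ⟨by simpa using hs, h⟩, rfl⟩, ?_⟩)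
    rw [dist_eq_norm, sub_sub_cancel_left, norm_neg, norm_smul, Real.norm_of_nonneg ht.le]
    exact ht1
  · push Not at h
    refine hball ?_
    rw [mem_ball, dist_eq_norm, show z + s - t • g - z = s - t • g by abel]
    have h1 := norm_sub_sq_real s (t • g)
    rw [real_inner_smul_right, norm_smul, Real.norm_of_nonneg ht.le, real_inner_comm] at h1
    refine lt_of_pow_lt_pow_left₀ 2 hr.le ?_
    have h2 : ‖s‖ ^ 2 ≤ r ^ 2 := by gcongr
    nlinarith [mul_lt_mul_of_pos_left h ht, mul_lt_mul_of_pos_left ht2 ht]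

/-- The center maximises the distance to the complement. If `0` were outside the hull, a separating
functional would show the way to shift the disc into the interior, where it could be enlarged. -/
lemma exists_incircle {K : Set Plane} (hK : Convex ℝ K) (hc : IsCompact K)
    (hi : (interior K).Nonempty) :
    ∃ z r, 0 < r ∧ closedBall z r ⊆ K ∧ (0 : Plane) ∈ convexHull ℝ (contactNormals K z r) := by
  have hcne : (Kᶜ).Nonempty := by
    rw [nonempty_compl]
    rintro rfl
    exact noncompact_univ Plane hc
  obtain ⟨z, hzK, hmax⟩ := hc.exists_isMaxOn (hi.mono interior_subset)
    (f := fun x => infDist x Kᶜ) (continuous_infDist_pt _).continuousOn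
  rw [isMaxOn_iff] at hmax
  obtain ⟨r, hr⟩ : ∃ r, r = infDist z Kᶜ := ⟨_, rfl⟩
  have hrpos : 0 < r := by
    obtain ⟨y, hy⟩ := hi
    rw [hr]
    refine lt_of_lt_of_le ?_ (hmax y (interior_subset hy))
    rw [← infDist_closure, ← isClosed_closure.notMem_iff_infDist_pos hcne.closure]
    rwa [closure_compl, notMem_compl_iff]
  have hb : closedBall z r ⊆ K := by
    rw [← closure_ball z hrpos.ne']
    exact closure_minimal (hr ▸ ball_infDist_compl_subset) hc.isClosed
  refine ⟨z, r, hrpos, hb, ?_⟩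
  set N : Set Plane := sphere 0 1 ∩ {u | z + r • u ∉ interior K} with hN
  have hNc : IsCompact N := (isCompact_sphere _ _).inter_right
    (isOpen_interior.isClosed_compl.preimage (by fun_prop : Continuous fun u : Plane => z + r • u))
  have hNM : N ⊆ contactNormals K z r := fun u hu =>
    mem_contactNormals_of_notMem_interior hK hrpos hb (by simpa using hu.1) hu.2
  refine convexHull_mono hNM ?_
  by_contra h0
  obtain ⟨f, c, hf1, hf2⟩ := geometric_hahn_banach_point_closed (convex_convexHull ℝ N)
    (isCompact_convexHull_of_isCompact hNc).isClosed h0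
  rw [map_zero] at hf1
  obtain ⟨z', hz'⟩ := exists_closedBall_subset_interior hrpos hb
    (g := (InnerProductSpace.toDual ℝ Plane).symm f) hf1 (fun u hu hun => by
      rw [InnerProductSpace.toDual_symm_apply]
      exact hf2 u (subset_convexHull _ _ ⟨by simpa using hu, hun⟩))
  obtain ⟨δ, hδ, hthick⟩ :=
    (isCompact_closedBall z' r).exists_thickening_subset_open isOpen_interior hz'
  rw [thickening_closedBall hδ hrpos.le] at hthick
  have h1 : r + δ ≤ infDist z' Kᶜ := by
    rw [le_infDist hcne]
    intro y hy
    by_contra! hlt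
    exact hy (interior_subset (hthick (by rw [mem_ball, dist_comm]; linarith)))
  have h2 := hmax z' (interior_subset (hz' (mem_closedBall_self hrpos.le)))
  linarith

/-- A convex body whose inradius is less than half its minimal width has three contact normals in
balance. -/
lemma exists_three_contactNormals {K : Set Plane} (hc : IsCompact K) (hne : K.Nonempty)
    {z : Plane} {r : ℝ} (h0 : (0 : Plane) ∈ convexHull ℝ (contactNormals K z r))
    (hrw : r < minimalWidth K / 2) (hw : 0 < minimalWidth K) :
    ∃ (u : Fin 3 → Plane) (l : Fin 3 → ℝ), (∀ i, u i ∈ contactNormals K z r) ∧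
      (∀ i, 0 < l i) ∧ (∀ i, l i * minimalWidth K ≤ r) ∧ l 0 + l 1 + l 2 = 1 ∧
      l 0 • u 0 + l 1 • u 1 + l 2 • u 2 = 0 := by
  obtain ⟨ι, _, u, l, hu, hind, hl, hsum, hbal⟩ := eq_pos_convex_span_of_mem_convexHull h0
  have hu' : ∀ i, u i ∈ contactNormals K z r := fun i => hu (mem_range_self i)
  have hle : ∀ i, l i * minimalWidth K ≤ r := by
    intro i
    obtain ⟨p, hp, hpi⟩ := exists_inner_le_sub_minimalWidth hc hne (hu' i).1
      (M := inner ℝ (u i) z + r) (fun x hx => by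
        have := (hu' i).2 x hx
        rw [inner_sub_right] at this
        linarith)
    -- By balance, the weighted distances from `p` to the contact lines add up to `r`. All terms are
    -- nonnegative, and the `i`-th is at least `l i * minimalWidth K`.
    have h1 : ∑ j, l j * inner ℝ (u j) (p - z) = 0 := by
      have := congrArg (fun x => inner ℝ x (p - z)) hbal
      simpa [sum_inner, real_inner_smul_left] using this
    have h2 : ∑ j, l j * (r - inner ℝ (u j) (p - z)) = r := by
      simp only [mul_sub, Finset.sum_sub_distrib, h1, ← Finset.sum_mul, hsum]; ring
    have h3 : l i * (r - inner ℝ (u i) (p - z)) ≤ r := by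
      refine le_of_le_of_eq ?_ h2
      exact Finset.single_le_sum (f := fun j => l j * (r - inner ℝ (u j) (p - z)))
        (fun j _ => mul_nonneg (hl j).le (sub_nonneg.2 ((hu' j).2 p hp))) (Finset.mem_univ i)
    refine le_trans (mul_le_mul_of_nonneg_left ?_ (hl i).le) h3
    rw [inner_sub_right]; linarith
  have hcard1 := card_le_three_of_affineIndependent hind
  -- Every weight is less than `1/2` and they add up to `1`, so two normals are too few.
  have hcard2 : 3 ≤ Fintype.card ι := by
    have hnem : Nonempty ι := by
      by_contra h
      rw [not_nonempty_iff] at h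
      simp at hsum
    have : ∑ i, l i < ∑ _i : ι, (1 / 2 : ℝ) := by
      refine Finset.sum_lt_sum_of_nonempty Finset.univ_nonempty fun i _ => ?_
      have := hle i
      by_contra! h
      nlinarith
    rw [hsum, Finset.sum_const, Finset.card_univ, nsmul_eq_mul] at this
    have h2 : (2 : ℝ) < Fintype.card ι := by linarith
    exact_mod_cast h2
  have e : Fin 3 ≃ ι := (Fintype.equivFinOfCardEq (le_antisymm hcard1 hcard2)).symm
  refine ⟨u ∘ e, l ∘ e, fun i => hu' _, fun i => hl _, fun i => hle _, ?_, ?_⟩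
  · rw [← hsum, ← e.sum_comp, Fin.sum_univ_three]; rfl
  · rw [← hbal, ← e.sum_comp, Fin.sum_univ_three]; rfl

/-! ### A lower bound for the area in terms of the inradius -/

/-- The open cone of half-angle `π / 3` around `e`. -/
def sector (e : Plane) : Set Plane := {x | ‖x‖ < 2 * inner ℝ e x}

lemma measurableSet_sector (e : Plane) : MeasurableSet (sector e) :=
  (isOpen_lt (by fun_prop) (by fun_prop)).measurableSet

lemma volume_closedBall_inter_sector_eq {e e' : Plane} (h : ‖e‖ = ‖e'‖) (r : ℝ) :
    volume.real (closedBall 0 r ∩ sector e) = volume.real (closedBall 0 r ∩ sector e') := by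
  set R := (ℝ ∙ (e - e'))ᗮ.reflection
  have hR : R e = e' := Submodule.reflection_sub h
  have hpre : closedBall 0 r ∩ sector e = R ⁻¹' (closedBall 0 r ∩ sector e') := by
    ext x
    simp only [sector, mem_inter_iff, mem_closedBall_zero_iff, mem_ofPred_eq, mem_preimage,
      LinearIsometryEquiv.norm_map, ← hR, LinearIsometryEquiv.inner_map_map]
  rw [hpre, measureReal_def, R.measurePreserving.measure_preimage
    (measurableSet_closedBall.inter (measurableSet_sector _)).nullMeasurableSet, ← measureReal_def]

/-- The sectors around the three vectors of a frame are disjoint, and reflections carry them into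
each other. -/
lemma volume_closedBall_inter_sector_le {e : Plane} (he : ‖e‖ = 1) (r : ℝ) :
    volume.real (closedBall 0 r ∩ sector e) ≤ volume.real (closedBall (0 : Plane) r) / 3 := by
  obtain ⟨v, hv, rfl⟩ := exists_isFrame he
  have hm : ∀ i, MeasurableSet (closedBall 0 r ∩ sector (v i)) := fun i =>
    measurableSet_closedBall.inter (measurableSet_sector _)
  have hdisj : Pairwise (Function.onFun Disjoint fun i => closedBall 0 r ∩ sector (v i)) := by
    intro i j hij
    refine Set.disjoint_left.2 fun x hxi hxj => ?_
    have h1 : ‖x‖ < 2 * inner ℝ (v i) x := hxi.2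
    have h2 : ‖x‖ < 2 * inner ℝ (v j) x := hxj.2
    have hs := hv.sum_inner x
    have hk : ∀ k, -‖x‖ ≤ inner ℝ (v k) x := fun k => by
      have := neg_le_of_abs_le (abs_real_inner_le_norm (v k) x)
      rwa [hv.norm_eq, one_mul] at this
    have k0 := hk 0
    have k1 := hk 1
    have k2 := hk 2
    fin_cases i <;> fin_cases j <;>
      first
      | exact absurd rfl hij
      | (simp only [Fin.zero_eta, Fin.mk_one, Fin.reduceFinMk] at h1 h2; linarith)
  have hU : volume.real (⋃ i, closedBall 0 r ∩ sector (v i)) ≤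
      volume.real (closedBall (0 : Plane) r) :=
    measureReal_mono (iUnion_subset fun i => inter_subset_left) measure_closedBall_lt_top.ne
  rw [measureReal_iUnion_fintype hdisj hm (fun i => measure_ne_top_of_subset inter_subset_left
    measure_closedBall_lt_top.ne), Fin.sum_univ_three,
    volume_closedBall_inter_sector_eq (e := v 1) (e' := v 0) (by simp [hv.norm_eq]),
    volume_closedBall_inter_sector_eq (e := v 2) (e' := v 0) (by simp [hv.norm_eq])] at hU
  linarith

lemma isOpen_image_openUnitTriangle {a b : Plane} (h : cross a b ≠ 0) :
    IsOpen (columnMap a b '' openUnitTriangle) := by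
  have hopen : IsOpen openUnitTriangle := by
    have : openUnitTriangle = {x : Plane | 0 < x 0} ∩ ({x | 0 < x 1} ∩ {x | x 0 + x 1 < 1}) := rfl
    rw [this]
    exact (isOpen_lt (by fun_prop) (by fun_prop)).inter
      ((isOpen_lt (by fun_prop) (by fun_prop)).inter (isOpen_lt (by fun_prop) (by fun_prop)))
  have hsurj : Function.Surjective (columnMap a b) :=
    (LinearMap.equivOfDetNeZero (columnMap a b) (by rwa [det_columnMap])).surjective
  exact (columnMap a b).isOpenMap_of_finiteDimensional hsurj _ hopen

/-- A point of the hull of the disc of radius `r` and of `p` that lies outside the disc is seen from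
the center in a direction close to that of `p`. -/
lemma lt_inner_of_lt_norm {s p : Plane} {r b : ℝ} (hb : 0 < b)
    (hs : ‖s‖ ≤ (1 - b) * r) (hx : r < ‖s + b • p‖) (hr : 0 < r) :
    r * ‖s + b • p‖ < inner ℝ p (s + b • p) := by
  set x := s + b • p with hxdef
  have h1 : ‖x‖ ^ 2 = inner ℝ s x + b * inner ℝ p x := by
    rw [← real_inner_self_eq_norm_sq]
    conv_lhs => rw [hxdef, inner_add_left, real_inner_smul_left, ← hxdef]
  have h2 : inner ℝ s x ≤ (1 - b) * r * ‖x‖ :=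
    (real_inner_le_norm _ _).trans (by gcongr)
  have hx0 : 0 < ‖x‖ := hr.trans hx
  have h3 : b * (r * ‖x‖) < b * inner ℝ p x := by nlinarith
  exact lt_of_mul_lt_mul_left h3 hb.le

/-- The cap is what two triangles leave outside the disc. Each has vertices `0`, `p` and a point of
the circle at angle `π / 3` from `p`, hence area `√3 / 4 * r * ‖p‖`. Both lie in `sector e`, so the
disc removes at most a third of its own area. The bound `r * ‖x‖ < inner ℝ p x` serves to separate
different caps. -/
lemma exists_cap {K : Set Plane} (hK : Convex ℝ K) {r : ℝ} (hr : 0 < r)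
    (hb : closedBall 0 r ⊆ K) {p : Plane} (hp : p ∈ K) (hp0 : p ≠ 0) :
    ∃ Q ⊆ K, MeasurableSet Q ∧ (∀ x ∈ Q, r < ‖x‖ ∧ r * ‖x‖ < inner ℝ p x) ∧
      √3 / 2 * r * ‖p‖ - volume.real (closedBall (0 : Plane) r) / 3 ≤ volume.real Q := by
  have h3 : √3 ^ 2 = 3 := Real.sq_sqrt (by norm_num)
  have hpn : 0 < ‖p‖ := norm_pos_iff.2 hp0
  set e : Plane := ‖p‖⁻¹ • p with he
  have hen : ‖e‖ = 1 := by rw [he, norm_smul, norm_inv, norm_norm, inv_mul_cancel₀ hpn.ne']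
  have hpe : p = ‖p‖ • e := by rw [he, smul_smul, mul_inv_cancel₀ hpn.ne', one_smul]
  set q := perp e
  have hqn : ‖q‖ = 1 := (norm_perp e).trans hen
  have heq : inner ℝ e q = (0 : ℝ) := inner_perp e
  have hqe : inner ℝ q e = (0 : ℝ) := by rw [real_inner_comm]; exact heq
  have hee : inner ℝ e e = (1 : ℝ) := by rw [real_inner_self_eq_norm_sq, hen]; norm_num
  have hqq : inner ℝ q q = (1 : ℝ) := by rw [real_inner_self_eq_norm_sq, hqn]; norm_num
  -- The sign `σ = ±1` selects the side of the axis through `p`. The angle `π / 3` is that of the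
  -- tangent points when `‖p‖ = 2 * r`, as for the equilateral triangle.
  set t : ℝ → Plane := fun σ => r • ((1 / 2 : ℝ) • e + (σ * (√3 / 2)) • q) with ht
  have htn : ∀ σ : ℝ, σ ^ 2 = 1 → ‖t σ‖ = r := fun σ hσ => by
    have h1 := norm_sq_pair hen hqn heq (1 / 2) (σ * (√3 / 2))
    rw [mul_pow, hσ, div_pow √3, h3] at h1
    have h2 : ‖(1 / 2 : ℝ) • e + (σ * (√3 / 2)) • q‖ = 1 := by
      rw [← sq_eq_sq₀ (norm_nonneg _) zero_le_one, h1]; norm_num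
    simp only [ht]
    rw [norm_smul, h2, mul_one, Real.norm_of_nonneg hr.le]
  set T : ℝ → Set Plane := fun σ => columnMap (t σ) p '' openUnitTriangle with hT
  have hcross : ∀ σ, cross (t σ) p = -(σ * (√3 / 2) * r * ‖p‖) := fun σ => by
    have h := norm_sq_eq_coord e
    rw [hen] at h
    rw [hpe]
    simp only [cross, ht, q, perp, PiLp.smul_apply, PiLp.add_apply, smul_eq_mul, norm_smul, hen,
      norm_norm]
    simp
    linear_combination (σ * (√3 / 2) * r * ‖p‖) * h
  have hvol : ∀ σ : ℝ, |σ| = 1 → volume.real (T σ) = √3 / 4 * r * ‖p‖ := fun σ hσ => by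
    simp only [hT]
    rw [volume_real_image_openUnitTriangle, hcross, abs_neg, abs_mul, abs_mul, abs_mul, hσ,
      abs_of_pos hr, abs_of_pos hpn, abs_of_pos (by positivity)]
    ring
  have hopen : ∀ σ : ℝ, σ ≠ 0 → IsOpen (T σ) := fun σ hσ =>
    isOpen_image_openUnitTriangle (by rw [hcross]; exact neg_ne_zero.2 (by positivity))
  have hmem : ∀ σ x, x ∈ T σ → ∃ a b : ℝ, 0 < a ∧ 0 < b ∧ a + b < 1 ∧ x = a • t σ + b • p := by
    rintro σ _ ⟨y, ⟨h0, h1, h2⟩, rfl⟩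
    exact ⟨y 0, y 1, h0, h1, h2, rfl⟩
  have hTK : ∀ σ : ℝ, σ ^ 2 = 1 → T σ ⊆ K := fun σ hσ x hx => by
    obtain ⟨a, b, ha, hb', hab, rfl⟩ := hmem σ x hx
    have h0 : (0 : Plane) ∈ K := hb (mem_closedBall_self hr.le)
    have ht : t σ ∈ K := hb (by rw [mem_closedBall_zero_iff, htn σ hσ])
    have := hK.sum_mem (t := Finset.univ) (w := ![a, b, 1 - a - b]) (z := ![t σ, p, 0])
      (by intro i _; fin_cases i <;> simp <;> linarith) (by simp [Fin.sum_univ_three])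
      (by intro i _; fin_cases i <;> simpa)
    simpa [Fin.sum_univ_three] using this
  have hsec : ∀ σ : ℝ, σ ^ 2 = 1 → T σ ⊆ sector e := fun σ hσ x hx => by
    obtain ⟨a, b, ha, hb', hab, rfl⟩ := hmem σ x hx
    have h1 : ‖a • t σ + b • p‖ ≤ a * r + b * ‖p‖ := by
      refine (norm_add_le _ _).trans ?_
      rw [norm_smul a, htn σ hσ, norm_smul b, Real.norm_of_nonneg ha.le, Real.norm_of_nonneg hb'.le]
    have h2 : inner ℝ e (a • t σ + b • p) = a * r / 2 + b * ‖p‖ := by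
      conv_lhs => rw [hpe]
      simp only [ht, inner_add_right, real_inner_smul_right, hee, heq]
      ring
    change ‖a • t σ + b • p‖ < 2 * inner ℝ e (a • t σ + b • p)
    rw [h2]
    nlinarith [mul_pos hb' hpn]
  have hcap : ∀ σ : ℝ, σ ^ 2 = 1 → ∀ x ∈ T σ, r < ‖x‖ → r * ‖x‖ < inner ℝ p x := by
    intro σ hσ x hx hrx
    obtain ⟨a, b, ha, hb', hab, rfl⟩ := hmem σ x hx
    refine lt_inner_of_lt_norm hb' ?_ hrx hr
    rw [norm_smul, htn σ hσ, Real.norm_of_nonneg ha.le]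
    gcongr
    linarith
  have hdisj : Disjoint (T 1) (T (-1)) := by
    have key : ∀ σ x, x ∈ T σ → ∃ a : ℝ, 0 < a ∧ inner ℝ q x = a * σ := by
      intro σ x hx
      obtain ⟨a, b, ha, hb', hab, rfl⟩ := hmem σ x hx
      refine ⟨a * r * (√3 / 2), by positivity, ?_⟩
      conv_lhs => rw [hpe]
      simp only [ht, inner_add_right, real_inner_smul_right, hqe, hqq]
      ring
    refine Set.disjoint_left.2 fun x h1 h2 => ?_
    obtain ⟨a, ha, ha'⟩ := key _ _ h1
    obtain ⟨b, hb, hb'⟩ := key _ _ h2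
    linarith
  have ho1 := hopen 1 one_ne_zero
  have ho2 := hopen (-1) (by norm_num)
  have hs1 : (1 : ℝ) ^ 2 = 1 := by norm_num
  have hs2 : (-1 : ℝ) ^ 2 = 1 := by norm_num
  refine ⟨(T 1 ∪ T (-1)) \ closedBall 0 r, ?_, ?_, ?_, ?_⟩
  · exact sdiff_subset.trans (union_subset (hTK 1 hs1) (hTK _ hs2))
  · exact (ho1.measurableSet.union ho2.measurableSet).diff measurableSet_closedBall
  · rintro x ⟨hx, hxr⟩
    rw [mem_closedBall_zero_iff, not_le] at hxr
    exact ⟨hxr, hx.elim (fun h => hcap 1 hs1 x h hxr) fun h => hcap _ hs2 x h hxr⟩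
  · have hfin : ∀ σ : ℝ, |σ| = 1 → volume (T σ) ≠ ⊤ := fun σ hσ h => by
      have := hvol σ hσ
      rw [measureReal_def, h, ENNReal.toReal_top] at this
      have : 0 < √3 / 4 * r * ‖p‖ := by positivity
      linarith
    have hf1 := hfin 1 (by simp)
    have hf2 := hfin (-1) (by simp)
    have hU := measureReal_union (μ := volume) hdisj ho2.measurableSet hf1 hf2
    rw [hvol 1 (by simp), hvol (-1) (by simp)] at hU
    have hsplit := measureReal_inter_add_sdiff (s := T 1 ∪ T (-1)) (t := closedBall 0 r)
      measurableSet_closedBall (measure_union_ne_top hf1 hf2)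
    have hle : volume.real ((T 1 ∪ T (-1)) ∩ closedBall 0 r) ≤
        volume.real (closedBall 0 r ∩ sector e) := by
      refine measureReal_mono ?_ (measure_ne_top_of_subset inter_subset_left
        measure_closedBall_lt_top.ne)
      rintro x ⟨hx, hxr⟩
      exact ⟨hxr, hx.elim (fun h => hsec 1 hs1 h) fun h => hsec _ hs2 h⟩
    have := volume_closedBall_inter_sector_le hen r
    linarith

/-- The hypotheses bound `inner ℝ p x` by `r * (b - a)`, and `b ≤ ‖x‖ + a` by the triangle
inequality. So a cone with `u i` as an edge misses the cap towards `p i`. -/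
lemma not_lt_inner_of_mem_cone {p x u u' : Plane} {r a b : ℝ} (hu : ‖u‖ = 1) (hu' : ‖u'‖ = 1)
    (ha : 0 ≤ a) (hb : 0 ≤ b) (hr : 0 ≤ r) (h : inner ℝ u p ≤ -r) (h' : inner ℝ u' p ≤ r)
    (hx : x = a • u + b • u') : inner ℝ p x ≤ r * ‖x‖ := by
  have h1 : ‖b • u'‖ ≤ ‖x‖ + ‖a • u‖ := by
    rw [show b • u' = x - a • u by rw [hx]; abel]
    exact norm_sub_le _ _
  rw [norm_smul, norm_smul, hu, hu', Real.norm_of_nonneg ha, Real.norm_of_nonneg hb] at h1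
  rw [hx, inner_add_right, real_inner_smul_right, real_inner_smul_right, real_inner_comm,
    real_inner_comm u', ← hx]
  nlinarith

/-- If `u 0` and `u 1` were parallel, then `l 2` would be `l 0 + l 1` or `|l 0 - l 1|`, and one of
the weights would equal `1/2`. -/
lemma cross_ne_zero_of_balanced {u : Fin 3 → Plane} {l : Fin 3 → ℝ} (hu : ∀ i, ‖u i‖ = 1)
    (hl : ∀ i, 0 < l i) (hl2 : ∀ i, l i < 1 / 2) (hsum : l 0 + l 1 + l 2 = 1)
    (hbal : l 0 • u 0 + l 1 • u 1 + l 2 • u 2 = 0) : cross (u 0) (u 1) ≠ 0 := by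
  intro h
  have h1 : ‖l 0 • u 0 + l 1 • u 1‖ = l 2 := by
    rw [eq_neg_of_add_eq_zero_left hbal, norm_neg, norm_smul, hu,
      Real.norm_of_nonneg (hl 2).le, mul_one]
  have h2 : l 2 ^ 2 = l 0 ^ 2 + 2 * l 0 * l 1 * inner ℝ (u 0) (u 1) + l 1 ^ 2 := by
    rw [← h1, norm_add_sq_real, norm_smul, norm_smul, hu, hu, real_inner_smul_left,
      real_inner_smul_right, Real.norm_of_nonneg (hl 0).le, Real.norm_of_nonneg (hl 1).le]
    ring
  have n0 := norm_sq_eq_coord (u 0)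
  have n1 := norm_sq_eq_coord (u 1)
  rw [hu] at n0 n1
  have h3 : (inner ℝ (u 0) (u 1) : ℝ) ^ 2 = 1 := by
    have e : (inner ℝ (u 0) (u 1) : ℝ) ^ 2 + cross (u 0) (u 1) ^ 2 =
        (u 0 0 ^ 2 + u 0 1 ^ 2) * (u 1 0 ^ 2 + u 1 1 ^ 2) := by
      rw [inner_eq_coord, cross]; ring
    rw [h, ← n0, ← n1] at e
    linarith
  have p0 := hl2 0
  have p1 := hl2 1
  have p2 := hl2 2
  have q0 := hl 0
  have q1 := hl 1
  rcases sq_eq_sq_iff_eq_or_eq_neg.1 (h3.trans (one_pow 2).symm) with h4 | h4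
  all_goals
    rw [h4] at h2
    obtain h5 : l 2 = 1 - l 0 - l 1 := by linarith
    rw [h5] at h2 p2
    nlinarith

/-- Adding a multiple of the positive relation `hbal` to an expansion of `x` in `u 0`, `u 1` makes
all coefficients nonnegative and one of them zero. -/
lemma exists_cone {u : Fin 3 → Plane} {l : Fin 3 → ℝ} (hl : ∀ i, 0 < l i)
    (hbal : l 0 • u 0 + l 1 • u 1 + l 2 • u 2 = 0) (hcross : cross (u 0) (u 1) ≠ 0) (x : Plane) :
    ∃ a b : ℝ, 0 ≤ a ∧ 0 ≤ b ∧
      (x = a • u 0 + b • u 1 ∨ x = a • u 0 + b • u 2 ∨ x = a • u 1 + b • u 2) := by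
  obtain ⟨s, t, hst⟩ : ∃ s t : ℝ, x = s • u 0 + t • u 1 := by
    refine ⟨cross x (u 1) / cross (u 0) (u 1), cross (u 0) x / cross (u 0) (u 1), ?_⟩
    ext i
    fin_cases i
    · simp only [Fin.zero_eta, PiLp.add_apply, PiLp.smul_apply, smul_eq_mul]
      field_simp
      simp only [cross]; ring
    · simp only [Fin.mk_one, PiLp.add_apply, PiLp.smul_apply, smul_eq_mul]
      field_simp
      simp only [cross]; ring
  have hshift : ∀ τ : ℝ, x = (s + τ * l 0) • u 0 + (t + τ * l 1) • u 1 + (τ * l 2) • u 2 := by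
    intro τ
    have : x = s • u 0 + t • u 1 + τ • (l 0 • u 0 + l 1 • u 1 + l 2 • u 2) := by
      rw [hbal, hst]; simp
    rw [this]; module
  have l0 := hl 0
  have l1 := hl 1
  have l2 := hl 2
  by_cases hs : 0 ≤ s ∧ 0 ≤ t
  · exact ⟨s, t, hs.1, hs.2, Or.inl hst⟩
  rcases le_total (s * l 1) (t * l 0) with h | h
  · have hs0 : s < 0 := by
      by_contra! hs0
      exact hs ⟨hs0, by by_contra! ht; nlinarith⟩
    refine ⟨t + -s / l 0 * l 1, -s / l 0 * l 2, ?_, ?_, Or.inr (Or.inr ?_)⟩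
    · have : t + -s / l 0 * l 1 = (t * l 0 - s * l 1) / l 0 := by field_simp; ring
      rw [this]
      exact div_nonneg (by linarith) l0.le
    · exact mul_nonneg (div_nonneg (by linarith) l0.le) l2.le
    · have := hshift (-s / l 0)
      rwa [show s + -s / l 0 * l 0 = 0 by field_simp; ring, zero_smul, zero_add] at this
  · have ht0 : t < 0 := by
      by_contra! ht0
      exact hs ⟨by by_contra! hs'; nlinarith, ht0⟩
    refine ⟨s + -t / l 1 * l 0, -t / l 1 * l 2, ?_, ?_, Or.inr (Or.inl ?_)⟩
    · have : s + -t / l 1 * l 0 = (s * l 1 - t * l 0) / l 1 := by field_simp; ring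
      rw [this]
      exact div_nonneg (by linarith) l1.le
    · exact mul_nonneg (div_nonneg (by linarith) l1.le) l2.le
    · have := hshift (-t / l 1)
      rwa [show t + -t / l 1 * l 1 = 0 by field_simp; ring, zero_smul, add_zero] at this

/-- The disc and three caps are disjoint. The caps lose at most a third of the disc each, so the
area of the disc cancels and only `3 * (√3 / 2 * r * d)` remains. -/
lemma area_ge_of_centered {K : Set Plane} (hK : Convex ℝ K) (hc : IsCompact K) {r d : ℝ}
    (hr : 0 < r) (hrd : r ≤ d) (hb : closedBall 0 r ⊆ K) {u p : Fin 3 → Plane} {l : Fin 3 → ℝ}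
    (hu : ∀ i, u i ∈ contactNormals K 0 r) (hl : ∀ i, 0 < l i) (hl2 : ∀ i, l i < 1 / 2)
    (hsum : l 0 + l 1 + l 2 = 1) (hbal : l 0 • u 0 + l 1 • u 1 + l 2 • u 2 = 0)
    (hp : ∀ i, p i ∈ K) (hup : ∀ i, inner ℝ (u i) (p i) ≤ -d) :
    3 * √3 / 2 * r * d ≤ volume.real K := by
  have hun : ∀ i, ‖u i‖ = 1 := fun i => (hu i).1
  have hule : ∀ i j, inner ℝ (u i) (p j) ≤ r := fun i j => by
    simpa using (hu i).2 (p j) (hp j)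
  have hupr : ∀ i, inner ℝ (u i) (p i) ≤ -r := fun i => (hup i).trans (by linarith)
  have hpd : ∀ i, d ≤ ‖p i‖ := fun i => by
    have := neg_le_of_abs_le (abs_real_inner_le_norm (u i) (p i))
    rw [hun, one_mul] at this
    linarith [hup i]
  have hp0 : ∀ i, p i ≠ 0 := fun i => norm_pos_iff.1 (by linarith [hpd i])
  choose Q hQK hQm hQ hQv using fun i => exists_cap hK hr hb (hp i) (hp0 i)
  -- The cones over pairs of normals cover the plane, and each meets at most one cap: the one
  -- belonging to the normal that is not an edge.
  have hdisj : Pairwise (Function.onFun Disjoint Q) := by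
    have hcone := exists_cone hl hbal (cross_ne_zero_of_balanced hun hl hl2 hsum hbal)
    have key : ∀ {i k : Fin 3} {x : Plane} {a b : ℝ}, 0 ≤ a → 0 ≤ b → x = a • u i + b • u k →
        x ∉ Q i := fun {i k x a b} ha hb hx hxQ =>
      absurd (hQ i x hxQ).2 (not_lt.2 (not_lt_inner_of_mem_cone (hun i) (hun k) ha hb hr.le
        (hupr i) (hule k i) hx))
    intro i j hij
    refine Set.disjoint_left.2 fun x hi hj => ?_
    obtain ⟨a, b, ha, hb, h | h | h⟩ := hcone x
    all_goals
      have h1 := key ha hb h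
      have h2 := key hb ha ((add_comm _ _).trans h.symm).symm
      fin_cases i <;> fin_cases j <;>
        first | exact absurd rfl hij | exact h1 hi | exact h1 hj | exact h2 hi | exact h2 hj
  have hQfin : ∀ i, volume (Q i) ≠ ⊤ := fun i =>
    measure_ne_top_of_subset (hQK i) hc.measure_ne_top
  have hD : Disjoint (closedBall (0 : Plane) r) (⋃ i, Q i) := by
    refine Set.disjoint_left.2 fun x hx hxQ => ?_
    obtain ⟨i, hi⟩ := mem_iUnion.1 hxQ
    rw [mem_closedBall_zero_iff] at hx
    exact absurd (hQ i x hi).1 (not_lt.2 hx)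
  have hUK : closedBall (0 : Plane) r ∪ ⋃ i, Q i ⊆ K := union_subset hb (iUnion_subset hQK)
  have hle := measureReal_mono (μ := volume) hUK hc.measure_ne_top
  rw [measureReal_union hD (MeasurableSet.iUnion hQm) measure_closedBall_lt_top.ne
    (measure_ne_top_of_subset (subset_union_right.trans hUK) hc.measure_ne_top),
    measureReal_iUnion_fintype hdisj hQm hQfin, Fin.sum_univ_three] at hle
  have hlow : ∀ i, √3 / 2 * r * d ≤ √3 / 2 * r * ‖p i‖ := fun i => by gcongr; exact hpd i
  linarith [hlow 0, hlow 1, hlow 2, hQv 0, hQv 1, hQv 2]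

lemma area_ge {K : Set Plane} (hK : Convex ℝ K) (hc : IsCompact K) (hw : 0 < minimalWidth K)
    {z : Plane} {r : ℝ} (hr : 0 < r) (hrw : r < minimalWidth K / 2) (hb : closedBall z r ⊆ K)
    {u : Fin 3 → Plane} {l : Fin 3 → ℝ} (hu : ∀ i, u i ∈ contactNormals K z r)
    (hl : ∀ i, 0 < l i) (hlw : ∀ i, l i * minimalWidth K ≤ r) (hsum : l 0 + l 1 + l 2 = 1)
    (hbal : l 0 • u 0 + l 1 • u 1 + l 2 • u 2 = 0) :
    3 * √3 / 2 * r * (minimalWidth K - r) ≤ volume.real K := by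
  have hne : K.Nonempty := ⟨z, hb (mem_closedBall_self hr.le)⟩
  have hex : ∀ i, ∃ p ∈ K, inner ℝ (u i) p ≤ inner ℝ (u i) z + r - minimalWidth K := fun i =>
    exists_inner_le_sub_minimalWidth hc hne (hu i).1 fun x hx => by
      have := (hu i).2 x hx
      rw [inner_sub_right] at this
      linarith
  choose p hpK hp using hex
  have hvol : volume.real ((fun y => z + y) ⁻¹' K) = volume.real K := by
    rw [measureReal_def, measure_preimage_add, ← measureReal_def]
  rw [← hvol]
  refine area_ge_of_centered (hK.translate_preimage_right z)
    ((Homeomorph.addLeft z).isCompact_preimage.2 hc) hr (by linarith) (fun y hy => hb ?_)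
    (u := u) (p := fun i => p i - z) (fun i => ⟨(hu i).1, fun x hx => ?_⟩) hl (fun i => ?_)
    hsum hbal (fun i => ?_) (fun i => ?_)
  · simpa using hy
  · simpa using (hu i).2 (z + x) hx
  · have := hlw i
    by_contra! h
    nlinarith
  · simpa using hpK i
  · rw [inner_sub_right]
    linarith [hp i]

/-! ### Stability -/

/-- The balance is a triangle with sides `a`, `b`, `c`, and the law of cosines determines the angle.
Here `10` is `(21/10) / (21/100)`, from the bounds on the right side and on `2ab`. -/
lemma abs_inner_add_half_le {x y s : Plane} {a b c ε : ℝ} (hx : ‖x‖ = 1) (hy : ‖y‖ = 1)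
    (hs : ‖s‖ = 1) (hsum : a + b + c = 1) (hbal : a • x + b • y + c • s = 0) (hε : 0 ≤ ε)
    (hε' : ε ≤ 1 / 250) (ha : a ≤ 1 / 3 + ε) (hb : b ≤ 1 / 3 + ε) (hc : c ≤ 1 / 3 + ε) :
    |inner ℝ x y + 1 / 2| ≤ 10 * ε := by
  have h1 : c ^ 2 = a ^ 2 + 2 * a * b * inner ℝ x y + b ^ 2 := by
    have h : ‖a • x + b • y‖ ^ 2 = ‖c • s‖ ^ 2 := by
      rw [eq_neg_of_add_eq_zero_left hbal, norm_neg]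
    rw [norm_add_sq_real, norm_smul, norm_smul, norm_smul, hx, hy, hs, real_inner_smul_left,
      real_inner_smul_right, mul_one, mul_one, mul_one, Real.norm_eq_abs, Real.norm_eq_abs,
      Real.norm_eq_abs, sq_abs, sq_abs, sq_abs] at h
    linarith
  generalize (inner ℝ x y : ℝ) = k at *
  obtain ⟨d, rfl⟩ : ∃ d, a = 1 / 3 + d := ⟨a - 1 / 3, by ring⟩
  obtain ⟨f, rfl⟩ : ∃ f, b = 1 / 3 + f := ⟨b - 1 / 3, by ring⟩
  obtain rfl : c = 1 / 3 - d - f := by linarith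
  have hd1 : d ≤ ε := by linarith
  have hf1 : f ≤ ε := by linarith
  have hdf : -ε ≤ d + f := by linarith
  have hd2 : -(2 * ε) ≤ d := by linarith
  have hf2 : -(2 * ε) ≤ f := by linarith
  have h2 : 2 * (1 / 3 + d) * (1 / 3 + f) * (k + 1 / 2) = -(d + f) + 3 * d * f := by
    linear_combination -h1
  have h3 : |d * f| ≤ 4 * ε ^ 2 := by
    rw [abs_mul]
    have e1 : |d| ≤ 2 * ε := abs_le.2 ⟨by linarith, by linarith⟩
    have e2 : |f| ≤ 2 * ε := abs_le.2 ⟨by linarith, by linarith⟩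
    calc |d| * |f| ≤ (2 * ε) * (2 * ε) := by gcongr
      _ = 4 * ε ^ 2 := by ring
  have h4 := abs_le.1 h3
  have h5 : ε ^ 2 ≤ ε / 250 := by nlinarith
  have h6 : 21 / 100 ≤ 2 * (1 / 3 + d) * (1 / 3 + f) := by nlinarith
  have h7 : |2 * (1 / 3 + d) * (1 / 3 + f) * (k + 1 / 2)| ≤ 21 / 10 * ε := by
    rw [h2, abs_le]
    constructor <;> linarith
  rw [abs_mul, abs_of_pos (by linarith : 0 < 2 * (1 / 3 + d) * (1 / 3 + f))] at h7
  have h8 := mul_le_mul_of_nonneg_right h6 (abs_nonneg (k + 1 / 2))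
  linarith

lemma norm_pair_sub_le {e q : Plane} (he : ‖e‖ = 1) (hq : ‖q‖ = 1) (heq : inner ℝ e q = (0 : ℝ))
    {c s : ℝ} (hs : 0 ≤ s) (hcs : c ^ 2 + s ^ 2 = 1) :
    ‖((-1 / 2 : ℝ) • e + (√3 / 2) • q) - (c • e + s • q)‖ ≤ 2 * |c + 1 / 2| := by
  have h3 : √3 ^ 2 = 3 := Real.sq_sqrt (by norm_num)
  have hpos : 0 < √3 := by positivity
  have e1 : ((-1 / 2 : ℝ) • e + (√3 / 2) • q) - (c • e + s • q) =
      (-1 / 2 - c) • e + (√3 / 2 - s) • q := by module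
  refine abs_le_of_sq_le_sq' ?_ (by positivity) |>.2
  rw [e1, norm_sq_pair he hq heq, mul_pow, sq_abs]
  have hc1 : -1 ≤ c := by nlinarith
  have hc2 : c ≤ 1 := by nlinarith
  -- Both unit vectors lie on the same side of the axis `e`, so `√3 / 2 + s ≥ √3 / 2` and `|c - 1/2|
  -- ≤ 3/2` give `(√3 / 2 - s)² ≤ 3 (c + 1/2)²`.
  have h4 : (√3 / 2 - s) * (√3 / 2 + s) = (c + 1 / 2) * (c - 1 / 2) := by
    linear_combination h3 / 4 - hcs
  have h5 : (√3 / 2 - s) ^ 2 * (√3 / 2) ^ 2 ≤ (√3 / 2 - s) ^ 2 * (√3 / 2 + s) ^ 2 := by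
    gcongr; linarith
  have h6 : (√3 / 2 - s) ^ 2 * (√3 / 2 + s) ^ 2 = (c + 1 / 2) ^ 2 * (c - 1 / 2) ^ 2 := by
    rw [← mul_pow, h4, mul_pow]
  have h7 : (c - 1 / 2) ^ 2 ≤ 9 / 4 := by nlinarith
  have h8 := mul_le_mul_of_nonneg_left h7 (sq_nonneg (c + 1 / 2))
  rw [div_pow √3, h3] at h5
  nlinarith

/-- Almost balanced contact normals are close to an equilateral frame. -/
lemma exists_frame_near {u : Fin 3 → Plane} {l : Fin 3 → ℝ} {ε : ℝ} (hu : ∀ i, ‖u i‖ = 1)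
    (hl : ∀ i, 0 < l i) (hsum : l 0 + l 1 + l 2 = 1)
    (hbal : l 0 • u 0 + l 1 • u 1 + l 2 • u 2 = 0) (hε : 0 ≤ ε) (hε' : ε ≤ 1 / 250)
    (hlε : ∀ i, l i ≤ 1 / 3 + ε) : ∃ v, IsFrame v ∧ ∀ i, ‖v i - u i‖ ≤ 20 * ε := by
  set c : ℝ := inner ℝ (u 0) (u 1) with hc
  have hc1 : |c + 1 / 2| ≤ 10 * ε :=
    abs_inner_add_half_le (hu 0) (hu 1) (hu 2) hsum hbal hε hε' (hlε 0) (hlε 1) (hlε 2)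
  have hc2 : |inner ℝ (u 0) (u 2) + 1 / 2| ≤ 10 * ε :=
    abs_inner_add_half_le (hu 0) (hu 2) (hu 1) (by linarith) (by rw [← hbal]; abel) hε hε'
      (hlε 0) (hlε 2) (hlε 1)
  have hcb := abs_le.1 hc1
  have hs0 : 0 < 1 - c ^ 2 := by nlinarith
  set s := √(1 - c ^ 2) with hs
  have hspos : 0 < s := Real.sqrt_pos.2 hs0
  have hssq : s ^ 2 = 1 - c ^ 2 := Real.sq_sqrt hs0.le
  set q : Plane := s⁻¹ • (u 1 - c • u 0) with hq
  have h00 : inner ℝ (u 0) (u 0) = (1 : ℝ) := by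
    rw [real_inner_self_eq_norm_sq, hu]; norm_num
  have horth : inner ℝ (u 0) q = (0 : ℝ) := by
    rw [hq, real_inner_smul_right, inner_sub_right, real_inner_smul_right, h00, ← hc]; ring
  have hu1 : u 1 = c • u 0 + s • q := by
    rw [hq, smul_smul, mul_inv_cancel₀ hspos.ne', one_smul]; abel
  have hqn : ‖q‖ = 1 := by
    have h1 : ‖u 1 - c • u 0‖ ^ 2 = s ^ 2 := by
      rw [norm_sub_sq_real, real_inner_smul_right, real_inner_comm, ← hc, norm_smul, hu, hu,
        mul_one, Real.norm_eq_abs, sq_abs, hssq]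
      ring
    have h2 := (sq_eq_sq₀ (norm_nonneg _) hspos.le).1 h1
    rw [hq, norm_smul, h2, norm_inv, Real.norm_of_nonneg hspos.le, inv_mul_cancel₀ hspos.ne']
  refine ⟨pairFrame (u 0) q, isFrame_pairFrame (hu 0) hqn horth, fun i => ?_⟩
  have hl2 := hl 2
  fin_cases i
  · simp [pairFrame, hε]
  · have := norm_pair_sub_le (hu 0) hqn horth hspos.le (c := c) (by linarith)
    rw [← hu1] at this
    exact this.trans (by linarith)
  -- The balance gives the coordinates of `u 2`. It lies on the side of `-q`, because `s'` is
  -- nonnegative, so the same estimate applies with `-q`.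
  · set c' : ℝ := -(l 0 + l 1 * c) / l 2 with hc'
    set s' : ℝ := l 1 * s / l 2 with hs'
    have hu2 : u 2 = c' • u 0 + s' • (-q) := by
      have h1 : l 2 • u 2 = -(l 0 • u 0 + l 1 • u 1) := eq_neg_of_add_eq_zero_right hbal
      have h2 : u 2 = (l 2)⁻¹ • (l 2 • u 2) := by
        rw [smul_smul, inv_mul_cancel₀ hl2.ne', one_smul]
      rw [h2, h1, hu1, hc', hs']
      module
    have hqn' : ‖-q‖ = 1 := by rw [norm_neg, hqn]
    have horth' : inner ℝ (u 0) (-q) = (0 : ℝ) := by rw [inner_neg_right, horth, neg_zero]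
    have hcs : c' ^ 2 + s' ^ 2 = 1 := by
      rw [← norm_sq_pair (hu 0) hqn' horth', ← hu2, hu]; norm_num
    have hcc : inner ℝ (u 0) (u 2) = c' := by
      rw [hu2, inner_add_right, real_inner_smul_right, real_inner_smul_right, h00, horth']; ring
    have := norm_pair_sub_le (hu 0) hqn' horth' (s := s')
      (by have := hl 1; positivity) hcs
    rw [← hu2, smul_neg, ← sub_eq_add_neg, ← hcc] at this
    exact this.trans (by linarith)

/-- Let `m` be the largest `inner ℝ (v i) (x - z)`. Then `‖x - z‖ ≤ 2 * m`, so replacing `v i` by `u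
i` costs at most `2 * η * m`, and `m ≤ r + 2 * η * m`. -/
lemma subset_tri_of_near {K : Set Plane} {z : Plane} {r η : ℝ} {u v : Fin 3 → Plane}
    (hu : ∀ i, u i ∈ contactNormals K z r) (hv : IsFrame v) (h : ∀ i, ‖v i - u i‖ ≤ η)
    (hη : η < 1 / 2) : K ⊆ tri v z (3 * r / (1 - 2 * η)) := by
  intro x hx
  obtain ⟨i, hi⟩ := Finite.exists_max fun i => (inner ℝ (v i) (x - z) : ℝ)
  have h1 := hv.norm_le_of_inner_le hi
  have h2 : inner ℝ (v i) (x - z) = inner ℝ (u i) (x - z) + inner ℝ (v i - u i) (x - z) := by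
    rw [inner_sub_left]; ring
  have h3 := (hu i).2 x hx
  have h4 : inner ℝ (v i - u i) (x - z) ≤ η * (2 * inner ℝ (v i) (x - z)) :=
    (real_inner_le_norm _ _).trans
      (mul_le_mul (h i) h1 (norm_nonneg _) ((norm_nonneg _).trans (h i)))
  intro j
  refine (hi j).trans ?_
  rw [show 3 * r / (1 - 2 * η) / 3 = r / (1 - 2 * η) by ring, le_div_iff₀ (by linarith)]
  linarith

/-- If `K` lies in a slightly larger concentric triangle, its symmetric difference with the smaller
one is controlled by the areas. -/
lemma measureReal_symmDiff_tri_le {K : Set Plane} (hc : IsCompact K) {v : Fin 3 → Plane}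
    (hv : IsFrame v) (z : Plane) {w W : ℝ} (hw : 0 < w) (hwW : w ≤ W) (hKW : K ⊆ tri v z W) :
    volume.real (K ∆ tri v z w) ≤
      2 * ((W ^ 2 - w ^ 2) / √3) - (volume.real K - w ^ 2 / √3) := by
  have hW : 0 < W := hw.trans_le hwW
  have hcW := isCompact_tri hv z hW
  rw [measureReal_symmDiff_of_isCompact hc (isCompact_tri hv z hw), volume_real_tri hv z hw]
  have h1 := measureReal_inter_add_sdiff (s := K) (t := tri v z w)
    (isClosed_tri v z w).measurableSet (hc.measure_ne_top (μ := volume))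
  have h2 : volume.real (K \ tri v z w) ≤ volume.real (tri v z W \ tri v z w) :=
    measureReal_mono (sdiff_subset_sdiff_left hKW)
      (measure_ne_top_of_subset sdiff_subset hcW.measure_ne_top)
  rw [measureReal_sdiff (tri_mono v z hwW) (isClosed_tri v z w).measurableSet hcW.measure_ne_top,
    volume_real_tri hv z hw, volume_real_tri hv z hW, ← sub_div] at h2
  linarith

lemma sqrt_three_bounds : 1.732 < √3 ∧ √3 < 1.7321 :=
  ⟨Real.lt_sqrt_of_sq_lt (by norm_num), (Real.sqrt_lt' (by norm_num)).2 (by norm_num)⟩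

lemma one_div_sqrt_three : 1 / √3 = √3 / 3 := by
  have : √3 ^ 2 = 3 := Real.sq_sqrt (by norm_num)
  field_simp; linarith

/-- A bootstrap: the crude bound `ε < 1/6` first gives `ε < 1/100`, and then the factor `1/3 - ε` is
large enough for `84/100`. -/
lemma excess_le_of_deficit_lt {ε δ : ℝ} (hε0 : 0 ≤ ε) (hε6 : ε < 1 / 6)
    (h : 3 * √3 / 2 * (ε * (1 / 3 - ε)) ≤ δ) (hδ : δ < 1 / 340) :
    84 / 100 * ε ≤ δ ∧ ε ≤ 1 / 250 := by
  have h1 : 2.598 * (ε * (1 / 3 - ε)) ≤ δ := by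
    refine le_trans ?_ h
    have : 0 ≤ ε * (1 / 3 - ε) := mul_nonneg hε0 (by linarith)
    have := sqrt_three_bounds.1
    gcongr
    linarith
  have h2 : ε < 1 / 100 := by
    have := mul_le_mul_of_nonneg_left hε6.le hε0
    linarith
  have h3 := mul_le_mul_of_nonneg_left h2.le hε0
  exact ⟨by linarith, by linarith⟩

lemma sq_ratio_sub_one_le {ε : ℝ} (hε0 : 0 ≤ ε) (hε : ε ≤ 1 / 250) :
    1 ≤ (1 + 3 * ε) / (1 - 2 * (20 * ε)) ∧
      (((1 + 3 * ε) / (1 - 2 * (20 * ε))) ^ 2 - 1) * (√3 / 3) ≤ 70 * ε := by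
  have h40 : 0 < 1 - 2 * (20 * ε) := by linarith
  have hsq : ε ^ 2 ≤ ε / 250 := by nlinarith
  obtain ⟨θ, hθ⟩ : ∃ θ, θ = (1 + 3 * ε) / (1 - 2 * (20 * ε)) := ⟨_, rfl⟩
  rw [← hθ]
  have h1 : 1 ≤ θ := by rw [hθ, le_div_iff₀ h40]; linarith
  have h2 : θ ≤ 1 + 52 * ε := by rw [hθ, div_le_iff₀ h40]; nlinarith
  refine ⟨h1, ?_⟩
  have h3 : θ ^ 2 ≤ (1 + 52 * ε) ^ 2 := by gcongr
  have h4 : θ ^ 2 - 1 ≤ 116 * ε := by linarith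
  have h5 := sqrt_three_bounds.2
  calc (θ ^ 2 - 1) * (√3 / 3) ≤ 116 * ε * (1.7321 / 3) := by gcongr
    _ ≤ 70 * ε := by linarith

/-- The factor `402` lies just below the reciprocal of the stated constant, about `402.28`. It is
needed only for large deficit; for small deficit the argument gives at most `140 / 0.84 < 167`. -/
theorem fraenkelAsymmetry_le {K : Set Plane} (hK : Convex ℝ K) (hc : IsCompact K)
    (hi : (interior K).Nonempty) :
    fraenkelAsymmetry K ≤ 402 * (volume.real K / minimalWidth K ^ 2 - 1 / √3) := by
  have hw := minimalWidth_pos hc hi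
  have hleast := isLeast_fraenkelAsymmetry hc hw
  obtain ⟨w, hwdef⟩ : ∃ w, w = minimalWidth K := ⟨_, rfl⟩
  have hle : ∀ v z, IsFrame v → fraenkelAsymmetry K * w ^ 2 ≤ volume.real (K ∆ tri v z w) := by
    intro v z hv
    have := hleast.2 (tri_mem_asymmetryValues hw hv z)
    rwa [le_div_iff₀ (by positivity), ← hwdef] at this
  rw [← hwdef]
  have hw' : 0 < w := hwdef ▸ hw
  obtain ⟨hs1, hs2⟩ := sqrt_three_bounds
  obtain ⟨δ, hδ⟩ : ∃ δ, δ = volume.real K / w ^ 2 - 1 / √3 := ⟨_, rfl⟩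
  rw [← hδ]
  have hvol : volume.real K = (δ + 1 / √3) * w ^ 2 := by rw [hδ]; field_simp; ring
  rw [one_div_sqrt_three] at hvol
  have hw2 : 0 < w ^ 2 := by positivity
  -- The threshold makes `401 * δ ≥ 2 / √3`, which is what the bound by the sum of the two areas
  -- requires.
  by_cases hbig : 1 / 340 ≤ δ
  · obtain ⟨v, hv, -⟩ := exists_isFrame (e := EuclideanSpace.single 0 1) (by simp)
    have h1 := hle v 0 hv
    rw [measureReal_symmDiff_of_isCompact hc (isCompact_tri hv 0 hw'), volume_real_tri hv 0 hw',
      hvol, div_eq_mul_one_div (w ^ 2), one_div_sqrt_three] at h1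
    have h2 : 0 ≤ volume.real (K ∩ tri v 0 w) := measureReal_nonneg
    have h3 : fraenkelAsymmetry K * w ^ 2 ≤ (δ + 2 * √3 / 3) * w ^ 2 := by linarith
    have h4 := le_of_mul_le_mul_right h3 hw2
    linarith
  push Not at hbig
  obtain ⟨z, r, hr, hb, h0⟩ := exists_incircle hK hc hi
  have hrw : r < w / 2 := by
    by_contra! hrw
    have h1 := measureReal_mono (μ := volume) hb hc.measure_ne_top
    rw [measureReal_def, EuclideanSpace.volume_closedBall_fin_two, ENNReal.toReal_mul,
      ENNReal.toReal_pow, ENNReal.toReal_ofReal hr.le, ENNReal.toReal_ofReal Real.pi_pos.le,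
      hvol] at h1
    have h2 : (w / 2) ^ 2 * 3 ≤ r ^ 2 * Real.pi := by
      have := Real.pi_gt_three
      gcongr
    have h3 : 3 / 4 * w ^ 2 ≤ (δ + √3 / 3) * w ^ 2 := by linarith
    linarith [le_of_mul_le_mul_right h3 hw2]
  obtain ⟨u, l, hu, hl, hlw, hsum, hbal⟩ := exists_three_contactNormals hc
    (hi.mono interior_subset) h0 (hwdef ▸ hrw) hw
  have harea := area_ge hK hc hw hr (hwdef ▸ hrw) hb hu hl hlw hsum hbal
  rw [← hwdef] at harea hlw
  -- The number `ε` measures the excess of the inradius over that of the equilateral triangle. It is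
  -- nonnegative because the three weights, each at most `1/3 + ε`, add up to `1`.
  obtain ⟨ε, hε⟩ : ∃ ε, r = (1 / 3 + ε) * w := ⟨r / w - 1 / 3, by field_simp; ring⟩
  have hlε : ∀ i, l i ≤ 1 / 3 + ε := fun i => le_of_mul_le_mul_right (hε ▸ hlw i) hw'
  have hε0 : 0 ≤ ε := by linarith [hlε 0, hlε 1, hlε 2]
  have hε6 : ε < 1 / 6 := by
    have h : (1 / 3 + ε) * w < 1 / 2 * w := by linarith
    linarith [lt_of_mul_lt_mul_right h hw'.le]
  have hδε : 3 * √3 / 2 * (ε * (1 / 3 - ε)) ≤ δ := by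
    rw [hvol, hε] at harea
    have h1 : (3 * √3 / 2 * (ε * (1 / 3 - ε)) + √3 / 3) * w ^ 2 ≤ (δ + √3 / 3) * w ^ 2 := by
      refine le_of_eq_of_le ?_ harea
      ring
    have h2 := le_of_mul_le_mul_right h1 hw2
    linarith
  obtain ⟨hδε', hε250⟩ := excess_le_of_deficit_lt hε0 hε6 hδε hbig
  obtain ⟨v, hv, hvu⟩ := exists_frame_near (fun i => (hu i).1) hl hsum hbal hε0 hε250 hlε
  have hKW := subset_tri_of_near hu hv hvu (by linarith)
  obtain ⟨hθ1, hθ2⟩ := sq_ratio_sub_one_le hε0 hε250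
  obtain ⟨θ, hθ⟩ : ∃ θ, θ = (1 + 3 * ε) / (1 - 2 * (20 * ε)) := ⟨_, rfl⟩
  have hW : 3 * r / (1 - 2 * (20 * ε)) = θ * w := by rw [hθ, hε]; ring
  rw [← hθ] at hθ1 hθ2
  rw [hW] at hKW
  have h1 := (hle v z hv).trans
    (measureReal_symmDiff_tri_le hc hv z hw' (le_mul_of_one_le_left hw'.le hθ1) hKW)
  rw [hvol, div_eq_mul_one_div (_ - _), div_eq_mul_one_div (w ^ 2), one_div_sqrt_three] at h1
  have h2 : fraenkelAsymmetry K * w ^ 2 ≤ (2 * (θ ^ 2 - 1) * (√3 / 3) - δ) * w ^ 2 := by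
    refine h1.trans (le_of_eq ?_)
    ring
  have h3 := le_of_mul_le_mul_right h2 hw2
  linarith

lemma constant_le : 1 / (25 * (3 * √3 + 2) * √5) ≤ 1 / 402 := by
  have h1 := sqrt_three_bounds.1
  have h2 : 2.236 < √5 := Real.lt_sqrt_of_sq_lt (by norm_num)
  gcongr
  nlinarith

end Pal

theorem theorem3 :
    ∃ c₃ : ℝ, 0 < c₃ ∧ c₃ = 1 / (25 * (3 * Real.sqrt 3 + 2) * Real.sqrt 5) ∧
      ∀ K : ConvexBody Plane, (interior (K : Set Plane)).Nonempty →
        IsLeast (asymmetryValues K) (fraenkelAsymmetry K) ∧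
          MeasureTheory.volume.real (K : Set Plane) / minimalWidth K ^ 2 - 1 / Real.sqrt 3
            ≥ c₃ * fraenkelAsymmetry K := by
  refine ⟨_, by positivity, rfl, fun K hi => ?_⟩
  have hleast := Pal.isLeast_fraenkelAsymmetry K.isCompact (Pal.minimalWidth_pos K.isCompact hi)
  refine ⟨hleast, ?_⟩
  have h1 := Pal.fraenkelAsymmetry_le K.convex K.isCompact hi
  have h2 : 0 ≤ fraenkelAsymmetry K := by
    obtain ⟨E, -, -, h⟩ := hleast.1
    rw [h]
    positivity
  have h3 := mul_le_mul_of_nonneg_right Pal.constant_le h2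
  linarith
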